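/- For $m\ge 1$ and an integer $n\ge 0$ let $\mathcal P_m(n)$ be the number of partitions of $n$ into parts none of which exceeds $m$; equivalently, $\prod_{r=1}^m (1-t^r)^{-1}=\sum_{n\ge 0}\mathcal P_m(n)\,t^n$. Call a function on $\mathbb Z$ a quasi-polynomial if, for some modulus $\tau>0$, it is given by a polynomial on each residue class modulo $\tau$. Let $1\le m\le 10$. There is exactly one quasi-polynomial $W(\cdot,\mathcal S_m):\mathbb Z\to\mathbb R$ with $W(n,\mathcal S_m)=\mathcal P_m(n)$ for all integers $n\ge 0$. Put $\xi_m=\frac{m(m+1)}{4}$ and $V(s,\mathcal S_m)=W(s-\xi_m,\mathcal S_m)$ for $s\in\xi_m+\mathbb Z$. Then for all $s\in \xi_m+\mathbb Z$ (in particular $\mathcal P_m(s-\xi_m)=V(s,\mathcal S_m)$ whenever $s-\xi_m$ is a nonnegative integer): $$V(s,\mathcal S_1)=1,$$ $$V(s,\mathcal S_2)=\tfrac{s}{2}-\tfrac14\sin\pi s,$$ $$V(s,\mathcal S_3)=\tfrac{s^2}{12}-\tfrac{7}{72}-\tfrac18\cos\pi s+\tfrac29\cos\tfrac{2\pi s}{3},$$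 $$V(s,\mathcal S_4)=\tfrac{s^3}{144}-\tfrac{s}{96}(5+3\cos\pi s)+\tfrac18\sin\tfrac{\pi s}{2}-\tfrac{2}{9\sqrt3}\sin\tfrac{2\pi s}{3},$$ $$V(s,\mathcal S_5)=\tfrac{s^4}{2880}-\tfrac{11s^2}{1152}-\tfrac{s}{64}\sin\pi s+\tfrac{17083}{691200}-\tfrac{2}{27}\cos\tfrac{2\pi s}{3}+\tfrac{1}{8\sqrt2}\cos\tfrac{\pi s}{2}+\tfrac{2}{25}\left(-\cos\tfrac{2\pi s}{5}+\cos\tfrac{4\pi s}{5}\right),$$ $$\begin{aligned}V(s,\mathcal S_6)={}&\tfrac{s^5}{86400}-\tfrac{91s^3}{103680}+\tfrac{s^2}{768}\sin\pi s+\tfrac{s}{829440}\left(9191-10240\cos\tfrac{2\pi s}{3}\right)-\tfrac{161}{9216}\sin\pi s-\tfrac{1}{16\sqrt2}\sin\tfrac{\pi s}{2}\\&-\tfrac{1}{81\sqrt3}\sin\tfrac{2\pi s}{3}-\tfrac1{18}\sin\tfrac{\pi s}{3}+\tfrac{4}{25\sqrt5}\left(\sin\tfrac{\pi}{5}\sin\tfrac{4\pi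 s}{5}+\sin\tfrac{2\pi}{5}\sin\tfrac{2\pi s}{5}\right),\end{aligned}$$ $$\begin{aligned}V(s,\mathcal S_7)={}&\tfrac{s^6}{3628800}-\tfrac{s^4}{20736}+\tfrac{s^2}{38400}(71+25\cos\pi s)-\tfrac{s}{81\sqrt3}\sin\tfrac{2\pi s}{3}-\tfrac{52705}{6096384}-\tfrac{77}{4608}\cos\pi s-\tfrac1{32}\cos\tfrac{\pi s}{2}\\&-\tfrac{5}{486}\cos\tfrac{2\pi s}{3}-\tfrac1{18}\cos\tfrac{\pi s}{3}+\tfrac{2}{25\sqrt5}\left(\cos\tfrac{2\pi s}{5}-\cos\tfrac{4\pi s}{5}\right)+\tfrac{2}{49}\left(\cos\tfrac{2\pi s}{7}+\cos\tfrac{4\pi s}{7}+\cos\tfrac{6\pi s}{7}\right),\end{aligned}$$ $$\begin{aligned}V(s,\mathcal S_8)={}&\tfrac{s^7}{203212800}-\tfrac{17s^5}{9676800}+\tfrac{s^3}{8294400}(1343+225\cos\pi s)\\&+s\left(-\tfrac{16133}{4976640}-\tfrac1{256}\cos\tfrac{\pi s}{2}+\tfrac1{243}\cos\tfrac{2\pi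 s}{3}-\tfrac{31}{12288}\cos\pi s\right)\\&+\tfrac1{32}\left(\sin\tfrac{\pi s}{4}-\sin\tfrac{3\pi s}{4}\right)-\tfrac1{128}\sin\tfrac{\pi s}{2}+\tfrac{1}{162\sqrt3}\sin\tfrac{2\pi s}{3}+\tfrac1{18\sqrt3}\sin\tfrac{\pi s}{3}\\&+\tfrac{4}{125}\left(\sin\tfrac{2\pi}{5}\sin\tfrac{4\pi s}{5}-\sin\tfrac{\pi}{5}\sin\tfrac{2\pi s}{5}\right)\\&-\tfrac1{49}\left(\sin\tfrac{2\pi s}{7}\csc\tfrac{\pi}{7}-\sin\tfrac{4\pi s}{7}\csc\tfrac{2\pi}{7}+\sin\tfrac{6\pi s}{7}\csc\tfrac{3\pi}{7}\right),\end{aligned}$$ $$\begin{aligned}V(s,\mathcal S_9)={}&\tfrac{s^8}{14631321600}-\tfrac{19s^6}{418037760}+\tfrac{145597s^4}{16721510400}+\tfrac{s^3}{73728}\sin\pi s-s^2\left(\tfrac{67293991}{140460687360}+\tfrac1{4374}\cos\tfrac{2\pi s}{3}\right)\\&-s\left(\tfrac{1}{256\sqrt2}\sin\tfrac{\pi s}{2}+\tfrac{1}{1458\sqrt3}\sin\tfrac{2\pi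 s}{3}+\tfrac{205}{98304}\sin\pi s\right)+\tfrac{199596951167}{56184274944000}\\&+\tfrac1{64}\left(\cos\tfrac{\pi s}{4}\csc\tfrac{\pi}{8}-\cos\tfrac{3\pi s}{4}\csc\tfrac{3\pi}{8}\right)+\tfrac{2}{125}\left(\cos\tfrac{4\pi s}{5}-\cos\tfrac{2\pi s}{5}\right)\\&-\tfrac{5}{512\sqrt2}\cos\tfrac{\pi s}{2}+\tfrac{257}{17496}\cos\tfrac{2\pi s}{3}+\tfrac1{36\sqrt3}\cos\tfrac{\pi s}{3}+\tfrac{2}{81}\left(-\cos\tfrac{2\pi s}{9}+\cos\tfrac{4\pi s}{9}+\cos\tfrac{8\pi s}{9}\right)\\&-\tfrac1{98}\left(\cos\tfrac{2\pi s}{7}\csc\tfrac{\pi}{7}\csc\tfrac{2\pi}{7}+\cos\tfrac{4\pi s}{7}\csc\tfrac{2\pi}{7}\csc\tfrac{3\pi}{7}+\cos\tfrac{6\pi s}{7}\csc\tfrac{3\pi}{7}\csc\tfrac{\pi}{7}\right),\end{aligned}$$ $$\begin{aligned}V(s,\mathcal S_{10})={}&\tfrac{s^9}{1316818944000}-\tfrac{11s^7}{12541132800}+\tfrac{113113s^5}{358318080000}-\tfrac{\sin\pi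 s}{2949120}s^4-\tfrac{18063859s^3}{468202291200}\\&+s^2\left(\tfrac{1}{4374\sqrt3}\sin\tfrac{2\pi s}{3}+\tfrac{143}{1179648}\sin\pi s\right)\\&+s\left[\tfrac{273512277643}{240789749760000}+\tfrac{1}{512\sqrt2}\cos\tfrac{\pi s}{2}+\tfrac{7}{13122}\cos\tfrac{2\pi s}{3}+\tfrac1{625}\left(\cos\tfrac{4\pi s}{5}-\cos\tfrac{2\pi s}{5}\right)\right]\\&-\tfrac{2877523}{707788800}\sin\pi s-\tfrac{1211}{52488\sqrt3}\sin\tfrac{2\pi s}{3}-\tfrac{5}{1024\sqrt2}\sin\tfrac{\pi s}{2}-\tfrac1{108}\sin\tfrac{\pi s}{3}\\&+\tfrac{1}{64\sqrt2}\left(\csc\tfrac{3\pi}{8}\sin\tfrac{3\pi s}{4}-\csc\tfrac{\pi}{8}\sin\tfrac{\pi s}{4}\right)+\tfrac1{50}\left(\sin\tfrac{3\pi s}{5}-\sin\tfrac{\pi s}{5}\right)\\&-\tfrac{2\sqrt2}{625}\left(\tfrac{\sqrt5+2}{\sqrt{5+\sqrt5}}\sin\tfrac{2\pi s}{5}+\tfrac{\sqrt5-2}{\sqrt{5-\sqrt5}}\sin\tfrac{4\pi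 s}{5}\right)\\&-\tfrac1{196}\csc\tfrac{\pi}{7}\csc\tfrac{2\pi}{7}\csc\tfrac{3\pi}{7}\left(\sin\tfrac{6\pi s}{7}+\sin\tfrac{4\pi s}{7}-\sin\tfrac{2\pi s}{7}\right)\\&+\tfrac1{81}\left(\csc\tfrac{4\pi}{9}\sin\tfrac{8\pi s}{9}+\csc\tfrac{2\pi}{9}\sin\tfrac{4\pi s}{9}+\csc\tfrac{\pi}{9}\sin\tfrac{2\pi s}{9}\right).\end{aligned}$$ Moreover, as a function of real $s$, the right-hand side for each $m$ has the form $\sum_{j=1}^{m}R_j^m(s)\,s^{m-j}$, where $R^m_j$ is periodic with $L(j)=\operatorname{lcm}(1,2,\dots,j)$ as a period (not necessarily the least one); in particular all coefficients have the period $L(m)$. -/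

import Mathlib

namespace SylvesterWaves

open Real

/-- `𝓟_m(n)`: the number of partitions of `n` into parts none of which exceeds `m`. -/
def restrictedPartitionNumber (m n : ℕ) : ℕ :=
  (Nat.Partition.restricted n (fun i => i ≤ m)).card

/-- The Molien function `∏_{r=1}^m 1 / (1 - t^r)` of the degrees `1, 2, …, m`. -/
noncomputable def molien (m : ℕ) : PowerSeries ℚ :=
  ∏ r ∈ Finset.Icc 1 m, (1 - (PowerSeries.X : PowerSeries ℚ) ^ r)⁻¹

/-- `𝓛(m) = lcm(1, 2, …, m)`. -/
def lcmUpTo (m : ℕ) : ℕ := (Finset.Icc 1 m).lcm id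

/-- The shift `ξ(𝓢_m) = (1 + 2 + ⋯ + m) / 2 = m (m + 1) / 4`. -/
noncomputable def shift (m : ℕ) : ℝ := (m : ℝ) * ((m : ℝ) + 1) / 4

/-- A function on `ℤ` is a quasi-polynomial if on every residue class of some
modulus `τ > 0` it is given by a polynomial. -/
def IsQuasiPolynomial (f : ℤ → ℝ) : Prop :=
  ∃ τ : ℕ, 0 < τ ∧ ∃ p : ℤ → Polynomial ℝ,
    (∀ a : ℤ, p (a + (τ : ℤ)) = p a) ∧ ∀ n : ℤ, f n = (p n).eval (n : ℝ)

/-- `f` is the unshifted Sylvester wave `W(·, 𝓢_m)` on all of `ℤ`: the quasi-polynomial whose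
value at every integer `n ≥ 0` is `𝓟_m(n)`. -/
def IsSylvesterWave (m : ℕ) (f : ℤ → ℝ) : Prop :=
  IsQuasiPolynomial f ∧ ∀ n : ℕ, f (n : ℤ) = (restrictedPartitionNumber m n : ℝ)

/-- The cosecant. -/
noncomputable def csc (x : ℝ) : ℝ := 1 / sin x

noncomputable def V1 (_s : ℝ) : ℝ := 1

noncomputable def V2 (s : ℝ) : ℝ := s / 2 - 1 / 4 * sin (π * s)

noncomputable def V3 (s : ℝ) : ℝ :=
  s ^ 2 / 12 - 7 / 72 - 1 / 8 * cos (π * s) + 2 / 9 * cos (2 * π * s / 3)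

noncomputable def V4 (s : ℝ) : ℝ :=
  s ^ 3 / 144 - s / 96 * (5 + 3 * cos (π * s)) + 1 / 8 * sin (π * s / 2)
    - 2 / (9 * √3) * sin (2 * π * s / 3)

noncomputable def V5 (s : ℝ) : ℝ :=
  s ^ 4 / 2880 - 11 * s ^ 2 / 1152 - s / 64 * sin (π * s) + 17083 / 691200
    - 2 / 27 * cos (2 * π * s / 3) + 1 / (8 * √2) * cos (π * s / 2)
    + 2 / 25 * (-cos (2 * π * s / 5) + cos (4 * π * s / 5))

noncomputable def V6 (s : ℝ) : ℝ :=
  s ^ 5 / 86400 - 91 * s ^ 3 / 103680 + s ^ 2 / 768 * sin (π * s)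
    + s / 829440 * (9191 - 10240 * cos (2 * π * s / 3))
    - 161 / 9216 * sin (π * s) - 1 / (16 * √2) * sin (π * s / 2)
    - 1 / (81 * √3) * sin (2 * π * s / 3) - 1 / 18 * sin (π * s / 3)
    + 4 / (25 * √5) * (sin (π / 5) * sin (4 * π * s / 5) + sin (2 * π / 5) * sin (2 * π * s / 5))

noncomputable def V7 (s : ℝ) : ℝ :=
  s ^ 6 / 3628800 - s ^ 4 / 20736 + s ^ 2 / 38400 * (71 + 25 * cos (π * s))
    - s / (81 * √3) * sin (2 * π * s / 3)
    - 52705 / 6096384 - 77 / 4608 * cos (π * s) - 1 / 32 * cos (π * s / 2)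
    - 5 / 486 * cos (2 * π * s / 3) - 1 / 18 * cos (π * s / 3)
    + 2 / (25 * √5) * (cos (2 * π * s / 5) - cos (4 * π * s / 5))
    + 2 / 49 * (cos (2 * π * s / 7) + cos (4 * π * s / 7) + cos (6 * π * s / 7))

noncomputable def V8 (s : ℝ) : ℝ :=
  s ^ 7 / 203212800 - 17 * s ^ 5 / 9676800 + s ^ 3 / 8294400 * (1343 + 225 * cos (π * s))
    + s * (-(16133 / 4976640) - 1 / 256 * cos (π * s / 2) + 1 / 243 * cos (2 * π * s / 3)
      - 31 / 12288 * cos (π * s))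
    + 1 / 32 * (sin (π * s / 4) - sin (3 * π * s / 4)) - 1 / 128 * sin (π * s / 2)
    + 1 / (162 * √3) * sin (2 * π * s / 3) + 1 / (18 * √3) * sin (π * s / 3)
    + 4 / 125 * (sin (2 * π / 5) * sin (4 * π * s / 5) - sin (π / 5) * sin (2 * π * s / 5))
    - 1 / 49 * (sin (2 * π * s / 7) * csc (π / 7) - sin (4 * π * s / 7) * csc (2 * π / 7)
      + sin (6 * π * s / 7) * csc (3 * π / 7))

noncomputable def V9 (s : ℝ) : ℝ :=
  s ^ 8 / 14631321600 - 19 * s ^ 6 / 418037760 + 145597 * s ^ 4 / 16721510400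
    + s ^ 3 / 73728 * sin (π * s)
    - s ^ 2 * (67293991 / 140460687360 + 1 / 4374 * cos (2 * π * s / 3))
    - s * (1 / (256 * √2) * sin (π * s / 2) + 1 / (1458 * √3) * sin (2 * π * s / 3)
      + 205 / 98304 * sin (π * s))
    + 199596951167 / 56184274944000
    + 1 / 64 * (cos (π * s / 4) * csc (π / 8) - cos (3 * π * s / 4) * csc (3 * π / 8))
    + 2 / 125 * (cos (4 * π * s / 5) - cos (2 * π * s / 5))
    - 5 / (512 * √2) * cos (π * s / 2) + 257 / 17496 * cos (2 * π * s / 3)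
    + 1 / (36 * √3) * cos (π * s / 3)
    + 2 / 81 * (-cos (2 * π * s / 9) + cos (4 * π * s / 9) + cos (8 * π * s / 9))
    - 1 / 98 * (cos (2 * π * s / 7) * csc (π / 7) * csc (2 * π / 7)
      + cos (4 * π * s / 7) * csc (2 * π / 7) * csc (3 * π / 7)
      + cos (6 * π * s / 7) * csc (3 * π / 7) * csc (π / 7))

noncomputable def V10 (s : ℝ) : ℝ :=
  s ^ 9 / 1316818944000 - 11 * s ^ 7 / 12541132800 + 113113 * s ^ 5 / 358318080000
    - sin (π * s) / 2949120 * s ^ 4 - 18063859 * s ^ 3 / 468202291200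
    + s ^ 2 * (1 / (4374 * √3) * sin (2 * π * s / 3) + 143 / 1179648 * sin (π * s))
    + s * (273512277643 / 240789749760000 + 1 / (512 * √2) * cos (π * s / 2)
      + 7 / 13122 * cos (2 * π * s / 3)
      + 1 / 625 * (cos (4 * π * s / 5) - cos (2 * π * s / 5)))
    - 2877523 / 707788800 * sin (π * s) - 1211 / (52488 * √3) * sin (2 * π * s / 3)
    - 5 / (1024 * √2) * sin (π * s / 2) - 1 / 108 * sin (π * s / 3)
    + 1 / (64 * √2) * (csc (3 * π / 8) * sin (3 * π * s / 4) - csc (π / 8) * sin (π * s / 4))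
    + 1 / 50 * (sin (3 * π * s / 5) - sin (π * s / 5))
    - 2 * √2 / 625 * ((√5 + 2) / √(5 + √5) * sin (2 * π * s / 5)
      + (√5 - 2) / √(5 - √5) * sin (4 * π * s / 5))
    - 1 / 196 * csc (π / 7) * csc (2 * π / 7) * csc (3 * π / 7)
      * (sin (6 * π * s / 7) + sin (4 * π * s / 7) - sin (2 * π * s / 7))
    + 1 / 81 * (csc (4 * π / 9) * sin (8 * π * s / 9) + csc (2 * π / 9) * sin (4 * π * s / 9)
      + csc (π / 9) * sin (2 * π * s / 9))

/-- The closed form of the shifted wave `V(s, 𝓢_m)` for `1 ≤ m ≤ 10`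
(the value for other `m` is irrelevant). -/
noncomputable def waveFormula : ℕ → ℝ → ℝ
  | 1 => V1
  | 2 => V2
  | 3 => V3
  | 4 => V4
  | 5 => V5
  | 6 => V6
  | 7 => V7
  | 8 => V8
  | 9 => V9
  | 10 => V10
  | _ => fun _ => 0

end SylvesterWaves

namespace SylvesterWaves

open Real

/-! ### Generating function of the restricted partition numbers -/

section Molien

open PowerSeries PowerSeries.WithPiTopology

/-! Clearing one factor of the generating product gives P_{m+1}(n) = P_{m+1}(n - (m+1)) + P_m(n),
valid on all of ℤ once P is extended by zero (`partitionNumberInt_succ`). Because ξ_{m+1} = ξ_m +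
(m+1)/2, the centred variable makes this a symmetric difference equation, V_{m+1}(s + (m+1)/2) -
V_{m+1}(s - (m+1)/2) = V_m(s). The closed forms satisfy it for every real s (`V2_recurrence` to
`V10_recurrence`).

The equation determines V_{m+1} only up to a function of period m+1, so values on one window of that
length are also needed. The admissible s with |s| ≤ (m+1)/2 come from negative n, where the
partition number is 0; hence the closed form has to vanish there. Each closed form is even or odd,
which leaves at most five zeros to verify by exact trigonometry (`eq_zero_of_abs_le` and the
`_eq_zero` lemmas). `AgreesWithPartitions.succ` propagates agreement from the window to everything
on its right, and induction on m starts from the constant V_1.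

Grouping each closed form by powers of s exhibits coefficients of period lcm(1, …, j), so its
restriction to ξ_m + ℤ is a quasi-polynomial in n. A quasi-polynomial is determined by its values on
ℕ (`IsQuasiPolynomial.eq_of_natCast`); this gives uniqueness of the wave and its equality with the
closed form on negative integers too. -/

theorem mk_restrictedPartitionNumber_eq_molien (m : ℕ) :
    PowerSeries.mk (fun n => (restrictedPartitionNumber m n : ℚ)) = molien m := by
  have h₁ := Nat.Partition.hasProd_powerSeriesMk_card_restricted ℚ (fun i => i ≤ m)
  -- The index i stands for the part i + 1, so every factor with i ≥ m is 1 and the infinite product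
  -- collapses to a finite one.
  have h₂ := hasProd_prod_of_ne_finset_one (L := .unconditional ℕ) (s := Finset.range m)
    (f := fun i => if i + 1 ≤ m then ∑' j : ℕ, (X : ℚ⟦X⟧) ^ ((i + 1) * j) else 1)
    (fun i hi => by
      rw [if_neg]
      simpa [Nat.succ_le_iff] using hi)
  refine (h₁.unique h₂).trans ?_
  rw [molien, ← Finset.Ico_add_one_right_eq_Icc, Finset.prod_Ico_eq_prod_range,
    Nat.add_sub_cancel]
  refine Finset.prod_congr rfl fun i hi => ?_
  rw [if_pos (Nat.succ_le_of_lt (Finset.mem_range.1 hi))]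
  simp_rw [pow_mul, add_comm 1 i]
  rw [PowerSeries.eq_inv_iff_mul_eq_one (by simp)]
  exact tsum_pow_mul_one_sub_of_constantCoeff_eq_zero (by simp)

theorem coeff_molien (m n : ℕ) :
    coeff n (molien m) = (restrictedPartitionNumber m n : ℚ) := by
  rw [← mk_restrictedPartitionNumber_eq_molien, coeff_mk]

theorem molien_succ_mul (m : ℕ) : molien (m + 1) * (1 - X ^ (m + 1)) = molien m := by
  rw [molien, Finset.prod_Icc_succ_top (by omega), mul_assoc, PowerSeries.inv_mul_cancel _ (by simp),
    mul_one, molien]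

end Molien

/-! ### Extension by zero to ℤ and the recurrence in m -/

/-- The restricted partition number, extended by zero to negative integers. -/
noncomputable def partitionNumberInt (m : ℕ) (n : ℤ) : ℝ :=
  if 0 ≤ n then (restrictedPartitionNumber m n.toNat : ℝ) else 0

theorem partitionNumberInt_natCast (m n : ℕ) :
    partitionNumberInt m n = restrictedPartitionNumber m n := by
  simp [partitionNumberInt]

theorem partitionNumberInt_of_neg (m : ℕ) {n : ℤ} (hn : n < 0) : partitionNumberInt m n = 0 :=
  if_neg (not_le.2 hn)

/-- Coefficient comparison in `molien_succ_mul`. The extension by zero absorbs the case n < m + 1,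
so no side condition on n is left. -/
theorem partitionNumberInt_succ (m : ℕ) (n : ℤ) :
    partitionNumberInt (m + 1) n =
      partitionNumberInt (m + 1) (n - (m + 1 : ℕ)) + partitionNumberInt m n := by
  rcases lt_or_ge n 0 with hn | hn
  · rw [partitionNumberInt_of_neg _ hn, partitionNumberInt_of_neg _ hn,
      partitionNumberInt_of_neg _ (by omega), add_zero]
  lift n to ℕ using hn
  have h := congrArg (PowerSeries.coeff n) (molien_succ_mul m)
  rw [mul_sub, mul_one, map_sub, PowerSeries.coeff_mul_X_pow', coeff_molien] at h
  rw [partitionNumberInt_natCast, partitionNumberInt_natCast]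
  split_ifs at h with hle
  · rw [coeff_molien, coeff_molien, sub_eq_iff_eq_add'] at h
    rw [← Nat.cast_sub hle, partitionNumberInt_natCast]
    exact_mod_cast h
  · rw [partitionNumberInt_of_neg _ (by omega), zero_add]
    rw [sub_zero, coeff_molien] at h
    exact_mod_cast h

theorem partitionNumberInt_one {n : ℤ} (hn : 0 ≤ n) : partitionNumberInt 1 n = 1 := by
  lift n to ℕ using hn
  have h : molien 1 = PowerSeries.mk 1 := by
    rw [molien, Finset.Icc_self, Finset.prod_singleton, pow_one, eq_comm,
      PowerSeries.eq_inv_iff_mul_eq_one (by simp), PowerSeries.mk_one_mul_one_sub_eq_one]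
  have h' := coeff_molien 1 n
  rw [h, PowerSeries.coeff_mk, Pi.one_apply] at h'
  rw [partitionNumberInt_natCast]
  exact_mod_cast h'.symm

theorem shift_succ (m : ℕ) : shift (m + 1) = shift m + ((m + 1 : ℕ) : ℝ) / 2 := by
  simp only [shift]
  push_cast
  ring

/-! ### Agreement with partition numbers: the inductive step -/

/-- The closed form `V` agrees with the restricted partition numbers at all admissible points to the
right of `-m / 2`. -/
def AgreesWithPartitions (m : ℕ) (V : ℝ → ℝ) : Prop :=
  ∀ n : ℤ, -(m : ℝ) / 2 < n + shift m → V (n + shift m) = partitionNumberInt m n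

/-- The zeros settle the central window, and the difference equation then carries agreement
rightwards in strips of width m + 1. Agreement cannot be asked on the whole line: for m = 1 it
already fails at s = -1/2. -/
theorem AgreesWithPartitions.succ {m : ℕ} (hm : 1 ≤ m) {U V : ℝ → ℝ}
    (hU : AgreesWithPartitions m U)
    (hrec : ∀ s, V (s + ((m + 1 : ℕ) : ℝ) / 2) - V (s - ((m + 1 : ℕ) : ℝ) / 2) = U s)
    (hzero : ∀ n : ℤ, |n + shift (m + 1)| ≤ ((m + 1 : ℕ) : ℝ) / 2 → V (n + shift (m + 1)) = 0) :
    AgreesWithPartitions (m + 1) V := by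
  have hm' : (1 : ℝ) ≤ m := by exact_mod_cast hm
  have hshift : (0 : ℝ) < shift m := by unfold shift; positivity
  suffices H : ∀ (k : ℕ) (n : ℤ), -((m + 1 : ℕ) : ℝ) / 2 < n + shift (m + 1) →
      n + shift (m + 1) ≤ ((m + 1 : ℕ) : ℝ) * k + ((m + 1 : ℕ) : ℝ) / 2 →
      V (n + shift (m + 1)) = partitionNumberInt (m + 1) n by
    intro n hn
    obtain ⟨k, hk⟩ := exists_nat_ge (n + shift (m + 1))
    refine H k n hn (hk.trans ?_)
    push_cast
    nlinarith [(Nat.cast_nonneg k : (0 : ℝ) ≤ k)]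
  intro k
  induction k with
  | zero =>
    intro n hn hn'
    rw [Nat.cast_zero, mul_zero, zero_add] at hn'
    -- In the window n ≤ -ξ_m < 0, so the extended partition number is 0 and `hzero` is exactly what
    -- is needed.
    have hneg : n < 0 := by
      have : (n : ℝ) < 0 := by
        rw [shift_succ] at hn'
        linarith
      exact_mod_cast this
    rw [hzero n (abs_le.2 ⟨by linarith, hn'⟩), partitionNumberInt_of_neg _ hneg]
  | succ k ih =>
    intro n hn hn'
    rcases le_or_gt (n + shift (m + 1)) (((m + 1 : ℕ) : ℝ) * k + ((m + 1 : ℕ) : ℝ) / 2)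
      with h | h
    · exact ih n hn h
    have hk : 0 ≤ ((m + 1 : ℕ) : ℝ) * k := by positivity
    -- One step left of a point beyond (m+1)/2 is still to the right of -(m+1)/2, and the midpoint
    -- of the step is positive, hence in the range of `hU`.
    have h₁ := ih (n - (m + 1 : ℕ)) (by push_cast at *; linarith)
      (by push_cast at *; linarith)
    have h₂ := hU n (by rw [shift_succ] at h; push_cast at *; linarith)
    have h₃ := hrec (n + shift m)
    rw [partitionNumberInt_succ, ← h₁, ← h₂, ← h₃, shift_succ]
    push_cast
    ring_nf

/-- It suffices to check the vanishing of an even or odd closed form at half-integers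
`0 ≤ k / 2 ≤ m / 2` of the right parity. -/
theorem eq_zero_of_abs_le {m : ℕ} {V : ℝ → ℝ} (ε : ℝ) (hV : ∀ s, V (-s) = ε * V s)
    (hzero : ∀ k : ℕ, k ≤ m → (k : ℤ) % 2 = (m * (m + 1) / 2 : ℕ) % 2 → V (k / 2) = 0)
    (n : ℤ) (hn : |n + shift m| ≤ (m : ℝ) / 2) : V (n + shift m) = 0 := by
  obtain ⟨c, hc⟩ : ∃ c, m * (m + 1) = 2 * c := (Nat.even_mul_succ_self m).two_dvd
  -- Admissible points are s = (2n + c)/2 with c = m(m+1)/2, so 2s runs over the integers of the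
  -- same parity as c.
  have hs : n + shift m = ((2 * n + c : ℤ) : ℝ) / 2 := by
    have : (m : ℝ) * (m + 1) = 2 * c := by exact_mod_cast hc
    rw [shift, this]
    push_cast
    ring
  have hz : V (((2 * n + c).natAbs : ℕ) / 2) = 0 := by
    refine hzero _ ?_ (by omega)
    rw [hs, abs_div, abs_two, div_le_div_iff_of_pos_right two_pos] at hn
    have : |2 * n + (c : ℤ)| ≤ m := by exact_mod_cast hn
    rw [Int.abs_eq_natAbs] at this
    omega
  rw [hs]
  rcases Int.natAbs_eq (2 * n + c) with h | h
  · rw [h]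
    rwa [Int.cast_natCast]
  · rw [h, Int.cast_neg, neg_div, hV]
    simpa using Or.inr hz

/-! ### Quasi-polynomials and their periods -/

/-- On a residue class modulo the product of the two moduli both functions are single polynomials,
and these agree at the infinitely many nonnegative members of the class. -/
theorem IsQuasiPolynomial.eq_of_natCast {f g : ℤ → ℝ} (hf : IsQuasiPolynomial f)
    (hg : IsQuasiPolynomial g) (h : ∀ n : ℕ, f n = g n) : f = g := by
  obtain ⟨τ, hτ, p, hp, hfp⟩ := hf
  obtain ⟨σ, hσ, q, hq, hgq⟩ := hg
  funext a
  have hp' : ∀ k : ℕ, p (a + k * (τ * σ)) = p a := fun k => by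
    simpa [mul_assoc, mul_comm, mul_left_comm] using
      (show Function.Periodic p τ from hp).int_mul (k * σ) a
  have hq' : ∀ k : ℕ, q (a + k * (τ * σ)) = q a := fun k => by
    simpa [mul_assoc, mul_comm, mul_left_comm] using
      (show Function.Periodic q σ from hq).int_mul (k * τ) a
  have hτσ : (0 : ℤ) < τ * σ := by positivity
  have hpq : p a = q a := by
    refine Polynomial.eq_of_infinite_eval_eq _ _ ?_
    refine Set.infinite_of_injective_forall_mem
      -- The offset |a| makes every sampled integer nonnegative, since τσ ≥ 1.
      (f := fun k : ℕ => ((a + (k + a.natAbs : ℕ) * (τ * σ) : ℤ) : ℝ)) ?_ ?_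
    · intro k l hkl
      have h₁ : a + ((k + a.natAbs : ℕ) : ℤ) * (τ * σ) = a + ((l + a.natAbs : ℕ) : ℤ) * (τ * σ) := by
        exact Int.cast_injective (α := ℝ) hkl
      have h₂ := mul_right_cancel₀ hτσ.ne' (add_left_cancel h₁)
      omega
    · intro k
      have hnn : 0 ≤ a + ((k + a.natAbs : ℕ) : ℤ) * (τ * σ) := by
        have : (a.natAbs : ℤ) ≤ ((k + a.natAbs : ℕ) : ℤ) * (τ * σ) := by
          push_cast
          nlinarith [abs_nonneg a, Int.natCast_nonneg k]
        omega
      obtain ⟨N, hN⟩ := Int.eq_ofNat_of_zero_le hnn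
      have h₁ := h N
      rw [← hN, hfp, hgq, hp', hq'] at h₁
      exact h₁
  rw [hfp, hgq, hpq]

theorem dvd_lcmUpTo {q m : ℕ} (hq : 1 ≤ q) (hqm : q ≤ m) : q ∣ lcmUpTo m :=
  Finset.dvd_lcm (f := id) (Finset.mem_Icc.2 ⟨hq, hqm⟩)

theorem lcmUpTo_dvd {j m : ℕ} (hjm : j ≤ m) : lcmUpTo j ∣ lcmUpTo m :=
  Finset.lcm_mono (Finset.Icc_subset_Icc_right hjm)

theorem lcmUpTo_pos (m : ℕ) : 0 < lcmUpTo m := by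
  refine Nat.pos_of_ne_zero fun h => ?_
  obtain ⟨x, hx, hx0⟩ := (Finset.lcm_eq_zero_iff (f := id) (s := Finset.Icc 1 m)).1 h
  have := Finset.mem_Icc.1 (Finset.mem_coe.1 hx)
  simp only [id] at hx0
  omega

/-- `V` is a polynomial of degree less than `m` in `s`, in which the coefficient of `s ^ (m - j)` has
the period `lcm(1, …, j)`. -/
def HasPeriodicCoeffs (m : ℕ) (V : ℝ → ℝ) : Prop :=
  ∃ R : ℕ → ℝ → ℝ, (∀ j ∈ Finset.Icc 1 m, Function.Periodic (R j) (lcmUpTo j : ℝ)) ∧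
    ∀ s : ℝ, V s = ∑ j ∈ Finset.Icc 1 m, R j s * s ^ (m - j)

theorem HasPeriodicCoeffs.isQuasiPolynomial {m : ℕ} {V : ℝ → ℝ} (hV : HasPeriodicCoeffs m V)
    (c : ℝ) : IsQuasiPolynomial fun n => V (n + c) := by
  obtain ⟨R, hR, hVR⟩ := hV
  refine ⟨lcmUpTo m, lcmUpTo_pos m, fun n => ∑ j ∈ Finset.Icc 1 m,
    Polynomial.C (R j (n + c)) * (Polynomial.X + Polynomial.C c) ^ (m - j), fun a => ?_, fun n => ?_⟩
  · refine Finset.sum_congr rfl fun j hj => ?_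
    obtain ⟨k, hk⟩ := lcmUpTo_dvd (Finset.mem_Icc.1 hj).2
    have h := (hR j hj).nat_mul k (a + c)
    congr 2
    rw [← h, hk]
    push_cast
    ring_nf
  · simp [hVR, Polynomial.eval_finsetSum]

/-! ### The difference equation for the closed forms -/

section Recurrence

/-- This and the next three lemmas reduce an angle to y, y + π, -y or π - y modulo full turns. The
congruence is an auto-param, so an instance with explicit x, y, k serves directly as a pair of
`simp` rewrites for cosine and sine. -/
theorem trig_add_even (x y : ℝ) (k : ℤ) (h : x = y + k * (2 * π) := by push_cast; ring) :
    cos x = cos y ∧ sin x = sin y := by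
  rw [h]
  exact ⟨cos_add_int_mul_two_pi y k, sin_add_int_mul_two_pi y k⟩

theorem trig_add_odd (x y : ℝ) (k : ℤ) (h : x = y + π + k * (2 * π) := by push_cast; ring) :
    cos x = -cos y ∧ sin x = -sin y := by
  rw [h, cos_add_int_mul_two_pi, sin_add_int_mul_two_pi]
  exact ⟨cos_add_pi y, sin_add_pi y⟩

theorem trig_neg_even (x y : ℝ) (k : ℤ) (h : x = -y + k * (2 * π) := by push_cast; ring) :
    cos x = cos y ∧ sin x = -sin y := by
  rw [h, cos_add_int_mul_two_pi, sin_add_int_mul_two_pi]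
  exact ⟨cos_neg y, sin_neg y⟩

theorem trig_neg_odd (x y : ℝ) (k : ℤ) (h : x = π - y + k * (2 * π) := by push_cast; ring) :
    cos x = -cos y ∧ sin x = sin y := by
  rw [h, cos_add_int_mul_two_pi, sin_add_int_mul_two_pi]
  exact ⟨cos_pi_sub y, sin_pi_sub y⟩

/-- Moves the radical to the numerator, where `linear_combination` can remove it with √2 * √2 = 2.
-/
theorem div_mul_sqrt_two (a b : ℝ) : b / (a * √2) = b * √2 / (2 * a) := by
  rw [← mul_div_mul_right b (a * √2) (c := √2) (by positivity), mul_assoc a,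
    mul_self_sqrt zero_le_two, mul_comm a]

theorem div_mul_sqrt_three (a b : ℝ) : b / (a * √3) = b * √3 / (3 * a) := by
  rw [← mul_div_mul_right b (a * √3) (c := √3) (by positivity), mul_assoc a,
    mul_self_sqrt zero_le_three, mul_comm a]

theorem div_mul_sqrt_five (a b : ℝ) : b / (a * √5) = b * √5 / (5 * a) := by
  rw [← mul_div_mul_right b (a * √5) (c := √5) (by positivity), mul_assoc a,
    mul_self_sqrt (by norm_num), mul_comm a]

theorem csc_mul_sin {x : ℝ} (h₀ : 0 < x := by positivity)
    (hπ : x < π := by linarith [pi_pos]) : csc x * sin x = 1 :=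
  one_div_mul_cancel (sin_pos_of_pos_of_lt_pi h₀ hπ).ne'

theorem sin_two_pi_div_five : sin (2 * π / 5) = 2 * sin (π / 5) * cos (π / 5) := by
  rw [← sin_two_mul]
  ring_nf

/-- The product is 2 sin²(π/5) cos(π/5), a polynomial in the known value cos(π/5) = (1 + √5)/4. -/
theorem sin_pi_div_five_mul_sin_two_pi_div_five : sin (π / 5) * sin (2 * π / 5) = √5 / 4 := by
  have h := sin_sq_add_cos_sq (π / 5)
  have h₅ : √5 * √5 = 5 := mul_self_sqrt (by norm_num)
  rw [sin_two_pi_div_five]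
  rw [cos_pi_div_five] at h ⊢
  linear_combination (1 + √5) / 2 * h - (3 + √5) / 32 * h₅

/-- All nine recurrences work alike: addition formulas separate each harmonic in s from the constant
angle of the step, and that angle is reduced to a standard one. What remains is an identity linear
in the harmonics, modulo relations among radicals, sines and cosecants. Harmonics of period m + 1
with constant coefficients cancel in the difference. -/
theorem V2_recurrence (s : ℝ) : V2 (s + 1) - V2 (s - 1) = V1 s := by
  simp only [V2, V1, mul_add, mul_sub, sin_add, sin_sub, trig_add_odd (π * 1) 0 0, cos_zero,
    sin_zero]
  ring

theorem V3_recurrence (s : ℝ) : V3 (s + 3 / 2) - V3 (s - 3 / 2) = V2 s := by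
  simp only [V3, V2, mul_add, mul_sub, add_div, sub_div, cos_add, cos_sub,
    trig_add_odd (π * (3 / 2)) (π / 2) 0, trig_add_odd (2 * π * (3 / 2) / 3) 0 0, cos_zero,
    sin_zero, cos_pi_div_two, sin_pi_div_two]
  ring

theorem V4_recurrence (s : ℝ) : V4 (s + 2) - V4 (s - 2) = V3 s := by
  have h₃ : √3 * √3 = 3 := mul_self_sqrt zero_le_three
  simp only [V4, V3, mul_add, mul_sub, add_div, sub_div, cos_add, cos_sub, sin_add, sin_sub,
    trig_add_even (π * 2) 0 1, trig_add_odd (π * 2 / 2) 0 0,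
    trig_add_odd (2 * π * 2 / 3) (π / 3) 0, cos_zero, sin_zero, cos_pi_div_three, sin_pi_div_three,
    div_mul_sqrt_three]
  linear_combination 2 / 27 * cos (2 * π * s / 3) * h₃

theorem V5_recurrence (s : ℝ) : V5 (s + 5 / 2) - V5 (s - 5 / 2) = V4 s := by
  have h₂ : √2 * √2 = 2 := mul_self_sqrt zero_le_two
  simp only [V5, V4, mul_add, mul_sub, add_div, sub_div, cos_add, cos_sub, sin_add, sin_sub,
    trig_add_even (π * (5 / 2)) (π / 2) 1, trig_neg_even (2 * π * (5 / 2) / 3) (π / 3) 1,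
    trig_add_odd (π * (5 / 2) / 2) (π / 4) 0, trig_add_odd (2 * π * (5 / 2) / 5) 0 0,
    trig_add_even (4 * π * (5 / 2) / 5) 0 1, cos_zero, sin_zero, cos_pi_div_three,
    sin_pi_div_three, cos_pi_div_four, sin_pi_div_four, cos_pi_div_two, sin_pi_div_two,
    div_mul_sqrt_three, div_mul_sqrt_two]
  linear_combination 1 / 16 * sin (π * s / 2) * h₂

theorem V6_recurrence (s : ℝ) : V6 (s + 3) - V6 (s - 3) = V5 s := by
  have h₅ : √5 * √5 = 5 := mul_self_sqrt (by norm_num)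
  simp only [V6, V5, mul_add, mul_sub, add_div, sub_div, cos_add, cos_sub, sin_add, sin_sub,
    trig_add_odd (π * 3) 0 1, trig_add_even (2 * π * 3 / 3) 0 1, trig_add_odd (π * 3 / 3) 0 0,
    trig_add_odd (π * 3 / 2) (π / 2) 0, trig_add_even (4 * π * 3 / 5) (2 * π / 5) 1,
    trig_add_odd (2 * π * 3 / 5) (π / 5) 0, cos_zero, sin_zero, cos_pi_div_two, sin_pi_div_two,
    div_mul_sqrt_three, div_mul_sqrt_two, div_mul_sqrt_five]
  linear_combination 8 / 125 * √5 * (cos (4 * π * s / 5) - cos (2 * π * s / 5)) *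
    sin_pi_div_five_mul_sin_two_pi_div_five +
    2 / 125 * (cos (4 * π * s / 5) - cos (2 * π * s / 5)) * h₅

theorem V7_recurrence (s : ℝ) : V7 (s + 7 / 2) - V7 (s - 7 / 2) = V6 s := by
  have h₃ : √3 * √3 = 3 := mul_self_sqrt zero_le_three
  simp only [V7, V6, mul_add, mul_sub, add_div, sub_div, cos_add, cos_sub, sin_add, sin_sub,
    trig_add_odd (π * (7 / 2)) (π / 2) 1, trig_add_even (2 * π * (7 / 2) / 3) (π / 3) 1,
    trig_neg_even (π * (7 / 2) / 2) (π / 4) 1, trig_add_odd (π * (7 / 2) / 3) (π / 6) 0,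
    trig_add_odd (2 * π * (7 / 2) / 5) (2 * π / 5) 0,
    trig_neg_odd (4 * π * (7 / 2) / 5) (π / 5) 1, trig_add_odd (2 * π * (7 / 2) / 7) 0 0,
    trig_add_even (4 * π * (7 / 2) / 7) 0 1, trig_add_odd (6 * π * (7 / 2) / 7) 0 1,
    cos_zero, sin_zero, cos_pi_div_two, sin_pi_div_two, cos_pi_div_three, sin_pi_div_three,
    cos_pi_div_four, sin_pi_div_four, cos_pi_div_six, sin_pi_div_six,
    div_mul_sqrt_three, div_mul_sqrt_two, div_mul_sqrt_five]
  linear_combination -(s / 243) * cos (2 * π * s / 3) * h₃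

theorem V8_recurrence (s : ℝ) : V8 (s + 4) - V8 (s - 4) = V7 s := by
  have h₃ : √3 * √3 = 3 := mul_self_sqrt zero_le_three
  have h₇ : csc (π / 7) * sin (π / 7) = 1 := csc_mul_sin
  have h₇₂ : csc (2 * π / 7) * sin (2 * π / 7) = 1 := csc_mul_sin
  have h₇₃ : csc (3 * π / 7) * sin (3 * π / 7) = 1 := csc_mul_sin
  simp only [V8, V7, mul_add, mul_sub, add_div, sub_div, cos_add, cos_sub, sin_add, sin_sub,
    trig_add_even (π * 4) 0 2, trig_add_even (π * 4 / 2) 0 1,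
    trig_neg_odd (2 * π * 4 / 3) (π / 3) 1, trig_add_odd (π * 4 / 4) 0 0,
    trig_add_odd (3 * π * 4 / 4) 0 1, trig_add_odd (π * 4 / 3) (π / 3) 0,
    trig_neg_even (2 * π * 4 / 5) (2 * π / 5) 1, trig_add_odd (4 * π * 4 / 5) (π / 5) 1,
    trig_add_odd (2 * π * 4 / 7) (π / 7) 0, trig_add_even (4 * π * 4 / 7) (2 * π / 7) 1,
    trig_add_odd (6 * π * 4 / 7) (3 * π / 7) 1, cos_zero, sin_zero, cos_pi_div_three,
    sin_pi_div_three, div_mul_sqrt_three, div_mul_sqrt_five]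
  linear_combination 8 / 125 * (cos (2 * π * s / 5) - cos (4 * π * s / 5)) *
      sin_pi_div_five_mul_sin_two_pi_div_five + 2 / 49 * cos (2 * π * s / 7) * h₇ +
    2 / 49 * cos (4 * π * s / 7) * h₇₂ + 2 / 49 * cos (6 * π * s / 7) * h₇₃ +
    (cos (2 * π * s / 3) / 486 - cos (π * s / 3) / 54) * h₃

theorem V9_recurrence (s : ℝ) : V9 (s + 9 / 2) - V9 (s - 9 / 2) = V8 s := by
  have h₂ : √2 * √2 = 2 := mul_self_sqrt zero_le_two
  have h₇ : csc (π / 7) * sin (π / 7) = 1 := csc_mul_sin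
  have h₇₂ : csc (2 * π / 7) * sin (2 * π / 7) = 1 := csc_mul_sin
  have h₇₃ : csc (3 * π / 7) * sin (3 * π / 7) = 1 := csc_mul_sin
  have h₈ : csc (π / 8) * sin (π / 8) = 1 := csc_mul_sin
  have h₈₃ : csc (3 * π / 8) * sin (3 * π / 8) = 1 := csc_mul_sin
  simp only [V9, V8, mul_add, mul_sub, add_div, sub_div, cos_add, cos_sub, sin_add, sin_sub,
    trig_add_even (π * (9 / 2)) (π / 2) 2, trig_add_odd (2 * π * (9 / 2) / 3) 0 1,
    trig_add_even (π * (9 / 2) / 2) (π / 4) 1, trig_add_odd (π * (9 / 2) / 4) (π / 8) 0,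
    trig_add_odd (3 * π * (9 / 2) / 4) (3 * π / 8) 1,
    trig_neg_even (4 * π * (9 / 2) / 5) (2 * π / 5) 2,
    trig_neg_even (2 * π * (9 / 2) / 5) (π / 5) 1, trig_add_odd (π * (9 / 2) / 3) (π / 2) 0,
    trig_add_odd (2 * π * (9 / 2) / 9) 0 0, trig_add_even (4 * π * (9 / 2) / 9) 0 1,
    trig_add_even (8 * π * (9 / 2) / 9) 0 2, trig_add_odd (2 * π * (9 / 2) / 7) (2 * π / 7) 0,
    trig_neg_odd (4 * π * (9 / 2) / 7) (3 * π / 7) 1,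
    trig_neg_even (6 * π * (9 / 2) / 7) (π / 7) 2,
    cos_zero, sin_zero, cos_pi_div_two, sin_pi_div_two, cos_pi_div_four, sin_pi_div_four,
    div_mul_sqrt_three, div_mul_sqrt_two]
  linear_combination -(sin (2 * π * s / 7) * csc (π / 7) / 49) * h₇₂ +
    sin (4 * π * s / 7) * csc (2 * π / 7) / 49 * h₇₃ -
    sin (6 * π * s / 7) * csc (3 * π / 7) / 49 * h₇ +
    sin (π * s / 4) / 32 * h₈ - sin (3 * π * s / 4) / 32 * h₈₃ +
    (-(sin (π * s / 2) / 256) - s * cos (π * s / 2) / 512) * h₂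

/-- The nested radicals multiply harmonics of period dividing 10 and cancel in the difference, so
their values play no role here. -/
theorem V10_recurrence (s : ℝ) : V10 (s + 5) - V10 (s - 5) = V9 s := by
  have h₂ : √2 * √2 = 2 := mul_self_sqrt zero_le_two
  have h₃ : √3 * √3 = 3 := mul_self_sqrt zero_le_three
  have h₇ : csc (π / 7) * sin (π / 7) = 1 := csc_mul_sin
  have h₇₂ : csc (2 * π / 7) * sin (2 * π / 7) = 1 := csc_mul_sin
  have h₇₃ : csc (3 * π / 7) * sin (3 * π / 7) = 1 := csc_mul_sin
  have h₉ : csc (π / 9) * sin (π / 9) = 1 := csc_mul_sin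
  have h₉₂ : csc (2 * π / 9) * sin (2 * π / 9) = 1 := csc_mul_sin
  have h₉₄ : csc (4 * π / 9) * sin (4 * π / 9) = 1 := csc_mul_sin
  simp only [V10, V9, mul_add, mul_sub, add_div, sub_div, cos_add, cos_sub, sin_add, sin_sub,
    trig_add_odd (π * 5) 0 2, trig_add_odd (2 * π * 5 / 3) (π / 3) 1,
    trig_add_even (π * 5 / 2) (π / 2) 1, trig_neg_even (π * 5 / 3) (π / 3) 1,
    trig_neg_even (3 * π * 5 / 4) (π / 4) 2, trig_add_odd (π * 5 / 4) (π / 4) 0,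
    trig_add_odd (3 * π * 5 / 5) 0 1, trig_add_odd (π * 5 / 5) 0 0,
    trig_add_even (2 * π * 5 / 5) 0 1, trig_add_even (4 * π * 5 / 5) 0 2,
    trig_add_even (6 * π * 5 / 7) (2 * π / 7) 2, trig_neg_odd (4 * π * 5 / 7) (π / 7) 1,
    trig_add_odd (2 * π * 5 / 7) (3 * π / 7) 0, trig_add_even (8 * π * 5 / 9) (4 * π / 9) 2,
    trig_add_even (4 * π * 5 / 9) (2 * π / 9) 1, trig_add_odd (2 * π * 5 / 9) (π / 9) 0,
    cos_zero, sin_zero, cos_pi_div_two, sin_pi_div_two, cos_pi_div_three, sin_pi_div_three,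
    cos_pi_div_four, sin_pi_div_four, div_mul_sqrt_three, div_mul_sqrt_two]
  linear_combination
    -(cos (6 * π * s / 7) * csc (π / 7) * csc (3 * π / 7) / 98) * h₇₂ -
    cos (4 * π * s / 7) * csc (2 * π / 7) * csc (3 * π / 7) / 98 * h₇ -
    cos (2 * π * s / 7) * csc (2 * π / 7) * csc (π / 7) / 98 * h₇₃ -
    2 / 81 * cos (2 * π * s / 9) * h₉ + 2 / 81 * cos (4 * π * s / 9) * h₉₂ +
    2 / 81 * cos (8 * π * s / 9) * h₉₄ +
    (911 / 157464 - s ^ 2 / 13122) * cos (2 * π * s / 3) * h₃ +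
    (csc (π / 8) * cos (π * s / 4) - csc (3 * π / 8) * cos (3 * π * s / 4)) / 128 * h₂

end Recurrence

/-! ### Exact trigonometric relations at fifths, sevenths, eighths and ninths of π -/

section SpecialValues

theorem div_mul_sqrt_two_mul (a b : ℝ) : b / (a * √2) * (√2 / 2) = b / (2 * a) := by
  rw [div_mul_div_comm, mul_right_comm a, mul_div_mul_right _ _ (by positivity), mul_comm a]

theorem div_mul_sqrt_three_mul (a b : ℝ) : b / (a * √3) * (√3 / 2) = b / (2 * a) := by
  rw [div_mul_div_comm, mul_right_comm a, mul_div_mul_right _ _ (by positivity), mul_comm a]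

theorem csc_mul_eq {x y z : ℝ} (h : y = z * sin x) (h₀ : 0 < x := by positivity)
    (hπ : x < π := by linarith [pi_pos]) : csc x * y = z := by
  rw [h, mul_left_comm, csc_mul_sin h₀ hπ, mul_one]

theorem cos_two_pi_div_five : cos (2 * π / 5) = (√5 - 1) / 4 := by
  have h₅ : √5 * √5 = 5 := mul_self_sqrt (by norm_num)
  rw [mul_div_assoc, cos_two_mul, cos_pi_div_five]
  linear_combination 1 / 8 * h₅

theorem sin_pi_div_ten : sin (π / 10) = (√5 - 1) / 4 := by
  rw [← cos_two_pi_div_five, ← cos_pi_div_two_sub]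
  ring_nf

theorem sin_three_pi_div_ten : sin (3 * π / 10) = (1 + √5) / 4 := by
  rw [← cos_pi_div_five, ← cos_pi_div_two_sub]
  ring_nf

theorem sin_pi_div_five_mul_self : sin (π / 5) * sin (π / 5) = (5 - √5) / 8 := by
  have h₅ : √5 * √5 = 5 := mul_self_sqrt (by norm_num)
  have h := sin_sq_add_cos_sq (π / 5)
  rw [cos_pi_div_five] at h
  linear_combination h - 1 / 16 * h₅

theorem sin_two_pi_div_five_mul_self : sin (2 * π / 5) * sin (2 * π / 5) = (5 + √5) / 8 := by
  have h₅ : √5 * √5 = 5 := mul_self_sqrt (by norm_num)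
  have h := sin_sq_add_cos_sq (2 * π / 5)
  rw [cos_two_pi_div_five] at h
  linear_combination h - 1 / 16 * h₅

theorem sin_two_pi_div_five_mul_sin_pi_div_five : sin (2 * π / 5) * sin (π / 5) = √5 / 4 := by
  rw [mul_comm, sin_pi_div_five_mul_sin_two_pi_div_five]

theorem csc_mul_sin_fifths :
    csc (π / 5) * sin (π / 5) = 1 ∧ csc (2 * π / 5) * sin (2 * π / 5) = 1 ∧
    csc (π / 5) * sin (2 * π / 5) = (√5 + 1) / 2 ∧
    csc (2 * π / 5) * sin (π / 5) = (√5 - 1) / 2 := by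
  have h₅ : √5 * √5 = 5 := mul_self_sqrt (by norm_num)
  have h := sin_two_pi_div_five
  rw [cos_pi_div_five] at h
  refine ⟨csc_mul_sin, csc_mul_sin, csc_mul_eq ?_, csc_mul_eq ?_⟩
  · linear_combination h
  · linear_combination -(√5 - 1) / 2 * h - sin (π / 5) / 4 * h₅

/-- From sin²(2π/5) = (5 + √5)/8 and sin²(π/5) = (5 - √5)/8, the nested radicals are 2√2 times these
sines, so they can be traded for cosecants. -/
theorem sqrt_two_mul_radicals (x y : ℝ) :
    2 * √2 / 625 * ((√5 + 2) / √(5 + √5) * x + (√5 - 2) / √(5 - √5) * y) =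
      1 / 625 * ((√5 + 2) * (csc (2 * π / 5) * x) + (√5 - 2) * (csc (π / 5) * y)) := by
  have hlt : √5 < 5 := by
    rw [sqrt_lt' (by norm_num)]
    norm_num
  have hs : ∀ z w : ℝ, 0 < z → 0 < sin w → sin w * sin w = z / 8 → √2 / √z = csc w / 2 := by
    intro z w hz hw h
    have hz' : √z = 2 * √2 * sin w := by
      rw [sqrt_eq_iff_mul_self_eq hz.le (by positivity)]
      linear_combination -8 * h - 4 * sin w * sin w * mul_self_sqrt zero_le_two
    rw [hz', csc]
    field_simp
  have h₁ := hs (5 + √5) (2 * π / 5) (by positivity)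
    (sin_pos_of_pos_of_lt_pi (by positivity) (by linarith [pi_pos])) sin_two_pi_div_five_mul_self
  have h₂ := hs (5 - √5) (π / 5) (by linarith)
    (sin_pos_of_pos_of_lt_pi (by positivity) (by linarith [pi_pos])) sin_pi_div_five_mul_self
  linear_combination 2 / 625 * (√5 + 2) * x * h₁ + 2 / 625 * (√5 - 2) * y * h₂

theorem sin_sub_sin_two_mul (x y : ℝ) :
    sin (x + y) - sin (x - y) = 2 * sin y * cos x := by
  rw [sin_add, sin_sub]
  ring

/-- Products of sines and cosines of multiples of `π / 7`. -/
theorem sin_mul_cos_sevenths :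
    2 * sin (π / 7) * cos (π / 7) = sin (2 * π / 7) ∧
    2 * sin (π / 7) * cos (2 * π / 7) = sin (3 * π / 7) - sin (π / 7) ∧
    2 * sin (π / 7) * cos (3 * π / 7) = sin (3 * π / 7) - sin (2 * π / 7) ∧
    2 * sin (2 * π / 7) * cos (π / 7) = sin (3 * π / 7) + sin (π / 7) ∧
    2 * sin (2 * π / 7) * cos (2 * π / 7) = sin (3 * π / 7) ∧
    2 * sin (2 * π / 7) * cos (3 * π / 7) = sin (2 * π / 7) - sin (π / 7) ∧
    2 * sin (3 * π / 7) * cos (π / 7) = sin (3 * π / 7) + sin (2 * π / 7) ∧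
    2 * sin (3 * π / 7) * cos (2 * π / 7) = sin (2 * π / 7) + sin (π / 7) ∧
    2 * sin (3 * π / 7) * cos (3 * π / 7) = sin (π / 7) := by
  -- Folding 4π/7, 5π/7, 6π/7 back keeps every product-to-sum result in the span of the sines of
  -- π/7, 2π/7, 3π/7.
  have h₄ := trig_neg_odd (4 * π / 7) (3 * π / 7) 0
  have h₅ := trig_neg_odd (5 * π / 7) (2 * π / 7) 0
  have h₆ := trig_neg_odd (6 * π / 7) (π / 7) 0
  refine ⟨?_, ?_, ?_, ?_, ?_, ?_, ?_, ?_, ?_⟩ <;> rw [← sin_sub_sin_two_mul]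
  · rw [← add_div, ← sub_div, sub_self, zero_div, sin_zero, sub_zero]
    ring_nf
  · rw [show 2 * π / 7 + π / 7 = 3 * π / 7 by ring, show 2 * π / 7 - π / 7 = π / 7 by ring]
  · rw [show 3 * π / 7 + π / 7 = 4 * π / 7 by ring, show 3 * π / 7 - π / 7 = 2 * π / 7 by ring, h₄.2]
  · rw [show π / 7 + 2 * π / 7 = 3 * π / 7 by ring, show π / 7 - 2 * π / 7 = -(π / 7) by ring,
      sin_neg, sub_neg_eq_add]
  · rw [show 2 * π / 7 + 2 * π / 7 = 4 * π / 7 by ring, sub_self, sin_zero, sub_zero, h₄.2]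
  · rw [show 3 * π / 7 + 2 * π / 7 = 5 * π / 7 by ring, show 3 * π / 7 - 2 * π / 7 = π / 7 by ring,
      h₅.2]
  · rw [show π / 7 + 3 * π / 7 = 4 * π / 7 by ring, show π / 7 - 3 * π / 7 = -(2 * π / 7) by ring,
      sin_neg, sub_neg_eq_add, h₄.2]
  · rw [show 2 * π / 7 + 3 * π / 7 = 5 * π / 7 by ring,
      show 2 * π / 7 - 3 * π / 7 = -(π / 7) by ring, sin_neg, sub_neg_eq_add, h₅.2]
  · rw [show 3 * π / 7 + 3 * π / 7 = 6 * π / 7 by ring, sub_self, sin_zero, sub_zero, h₆.2]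

/-- Multiplied by 2 sin(π/7), the alternating sum of the three cosines telescopes to sin(π/7). -/
theorem cos_three_pi_div_seven : cos (3 * π / 7) = 1 / 2 - cos (π / 7) + cos (2 * π / 7) := by
  obtain ⟨h₁, h₂, h₃, -⟩ := sin_mul_cos_sevenths
  have h : sin (π / 7) ≠ 0 :=
    (sin_pos_of_pos_of_lt_pi (by positivity) (by linarith [pi_pos])).ne'
  apply mul_left_cancel₀ h
  linear_combination h₁ / 2 - h₂ / 2 + h₃ / 2

theorem csc_mul_sin_sevenths :
    csc (π / 7) * sin (π / 7) = 1 ∧ csc (2 * π / 7) * sin (2 * π / 7) = 1 ∧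
    csc (3 * π / 7) * sin (3 * π / 7) = 1 ∧
    csc (π / 7) * sin (2 * π / 7) = 2 * cos (π / 7) ∧
    csc (π / 7) * sin (3 * π / 7) = 1 + 2 * cos (2 * π / 7) ∧
    csc (2 * π / 7) * sin (π / 7) = 1 - 2 * cos (3 * π / 7) ∧
    csc (2 * π / 7) * sin (3 * π / 7) = 2 * cos (2 * π / 7) ∧
    csc (3 * π / 7) * sin (π / 7) = 2 * cos (3 * π / 7) ∧
    csc (3 * π / 7) * sin (2 * π / 7) = 2 * cos (π / 7) - 1 := by
  obtain ⟨h₁₁, h₁₂, -, -, h₂₂, h₂₃, h₃₁, -, h₃₃⟩ := sin_mul_cos_sevenths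
  refine ⟨csc_mul_sin, csc_mul_sin, csc_mul_sin, csc_mul_eq ?_, csc_mul_eq ?_, csc_mul_eq ?_,
    csc_mul_eq ?_, csc_mul_eq ?_, csc_mul_eq ?_⟩
  · linear_combination -h₁₁
  · linear_combination -h₁₂
  · linear_combination h₂₃
  · linear_combination -h₂₂
  · linear_combination -h₃₃
  · linear_combination -h₃₁

/-- An instance of sin 2A + sin 2B + sin 2C = 4 sin A sin B sin C for A + B + C = π, with angles
π/7, 2π/7, 4π/7. -/
theorem csc_mul_csc_mul_csc_sevenths :
    csc (π / 7) * csc (2 * π / 7) * csc (3 * π / 7) *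
      (sin (3 * π / 7) + sin (2 * π / 7) - sin (π / 7)) = 4 := by
  have h₁ : csc (π / 7) * sin (π / 7) = 1 := csc_mul_sin
  have h₂ : csc (2 * π / 7) * sin (2 * π / 7) = 1 := csc_mul_sin
  have h₃ : csc (3 * π / 7) * sin (3 * π / 7) = 1 := csc_mul_sin
  have hc : cos (π / 7) - cos (3 * π / 7) = 2 * sin (π / 7) * sin (2 * π / 7) := by
    rw [show π / 7 = 2 * π / 7 - π / 7 by ring, show 3 * π / 7 = 2 * π / 7 + π / 7 by ring,
      cos_sub, cos_add]
    ring_nf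
  obtain ⟨-, -, -, -, -, -, h₃₁, -, h₃₃⟩ := sin_mul_cos_sevenths
  have h : sin (3 * π / 7) + sin (2 * π / 7) - sin (π / 7) =
      4 * sin (π / 7) * sin (2 * π / 7) * sin (3 * π / 7) := by
    linear_combination 2 * sin (3 * π / 7) * hc - h₃₁ + h₃₃
  rw [h]
  linear_combination 4 * (csc (2 * π / 7) * sin (2 * π / 7)) * (csc (3 * π / 7) * sin (3 * π / 7)) *
    h₁ + 4 * (csc (3 * π / 7) * sin (3 * π / 7)) * h₂ + 4 * h₃

/-- Pulls out the full cosecant product, leaving a sum of sine-cosine products that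
`sin_mul_cos_sevenths` makes linear in sines. -/
theorem cos_mul_csc_mul_csc_sevenths (x y z : ℝ) :
    x * csc (π / 7) * csc (2 * π / 7) + y * csc (2 * π / 7) * csc (3 * π / 7) +
      z * csc (3 * π / 7) * csc (π / 7) =
    csc (π / 7) * csc (2 * π / 7) * csc (3 * π / 7) *
      (x * sin (3 * π / 7) + y * sin (π / 7) + z * sin (2 * π / 7)) := by
  have h₁ : csc (π / 7) * sin (π / 7) = 1 := csc_mul_sin
  have h₂ : csc (2 * π / 7) * sin (2 * π / 7) = 1 := csc_mul_sin
  have h₃ : csc (3 * π / 7) * sin (3 * π / 7) = 1 := csc_mul_sin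
  linear_combination -(x * csc (π / 7) * csc (2 * π / 7)) * h₃ -
    y * csc (2 * π / 7) * csc (3 * π / 7) * h₁ - z * csc (3 * π / 7) * csc (π / 7) * h₂

theorem csc_mul_eighths :
    csc (π / 8) * sin (π / 8) = 1 ∧ csc (3 * π / 8) * sin (3 * π / 8) = 1 ∧
    csc (π / 8) * sin (3 * π / 8) = 1 + √2 ∧ csc (3 * π / 8) * sin (π / 8) = √2 - 1 ∧
    csc (π / 8) * cos (π / 8) = 1 + √2 ∧ csc (3 * π / 8) * cos (3 * π / 8) = √2 - 1 ∧
    csc (π / 8) * cos (3 * π / 8) = 1 ∧ csc (3 * π / 8) * cos (π / 8) = 1 := by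
  have h₂ : √2 * √2 = 2 := mul_self_sqrt zero_le_two
  have hs : sin (3 * π / 8) = cos (π / 8) := by
    rw [← cos_pi_div_two_sub]
    ring_nf
  have hc : cos (3 * π / 8) = sin (π / 8) := by
    rw [← sin_pi_div_two_sub]
    ring_nf
  -- This is cot(π/8) = 1 + √2, from the double-angle formulas at π/4 after multiplying by cos(π/8).
  have h : cos (π / 8) = (1 + √2) * sin (π / 8) := by
    have h₀ : cos (π / 8) ≠ 0 :=
      (cos_pos_of_mem_Ioo ⟨by linarith [pi_pos], by linarith [pi_pos]⟩).ne'
    have h₁ := sin_two_mul (π / 8)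
    have h₃ := cos_two_mul (π / 8)
    rw [show 2 * (π / 8) = π / 4 by ring] at h₁ h₃
    rw [sin_pi_div_four] at h₁
    rw [cos_pi_div_four] at h₃
    apply mul_left_cancel₀ h₀
    linear_combination -h₃ / 2 + (1 + √2) / 2 * h₁ - h₂ / 4
  have h' : sin (π / 8) = (√2 - 1) * cos (π / 8) := by
    linear_combination (1 - √2) * h - sin (π / 8) * h₂
  refine ⟨csc_mul_sin, csc_mul_sin, csc_mul_eq ?_, csc_mul_eq ?_, csc_mul_eq h, csc_mul_eq ?_,
    csc_mul_eq ?_, csc_mul_eq ?_⟩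
  · rw [hs, h]
  · rw [hs, ← h']
  · rw [hs, hc, ← h']
  · rw [hc, one_mul]
  · rw [hs, one_mul]

/-- The angles 2π/9 and 4π/9 are π/3 ∓ π/9, and 2 cos(π/3) = 1. -/
theorem cos_pi_div_nine : cos (π / 9) = cos (2 * π / 9) + cos (4 * π / 9) := by
  have h₁ : cos (4 * π / 9) = cos (π / 3) * cos (π / 9) - sin (π / 3) * sin (π / 9) := by
    rw [← cos_add]
    ring_nf
  have h₂ : cos (2 * π / 9) = cos (π / 3) * cos (π / 9) + sin (π / 3) * sin (π / 9) := by
    rw [← cos_sub]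
    ring_nf
  rw [h₁, h₂, cos_pi_div_three]
  ring

/-- Products of sines and cosines of multiples of `π / 9`. -/
theorem sin_mul_cos_ninths :
    2 * sin (π / 9) * cos (π / 9) = sin (2 * π / 9) ∧
    2 * sin (π / 9) * cos (2 * π / 9) = √3 / 2 - sin (π / 9) ∧
    2 * sin (π / 9) * cos (4 * π / 9) = sin (4 * π / 9) - √3 / 2 ∧
    2 * sin (2 * π / 9) * cos (π / 9) = √3 / 2 + sin (π / 9) ∧
    2 * sin (2 * π / 9) * cos (2 * π / 9) = sin (4 * π / 9) ∧
    2 * sin (2 * π / 9) * cos (4 * π / 9) = √3 / 2 - sin (2 * π / 9) ∧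
    2 * sin (4 * π / 9) * cos (π / 9) = sin (4 * π / 9) + √3 / 2 ∧
    2 * sin (4 * π / 9) * cos (2 * π / 9) = √3 / 2 + sin (2 * π / 9) ∧
    2 * sin (4 * π / 9) * cos (4 * π / 9) = sin (π / 9) := by
  have h₅ := trig_neg_odd (5 * π / 9) (4 * π / 9) 0
  have h₆ := trig_neg_odd (6 * π / 9) (π / 3) 0
  have h₈ := trig_neg_odd (8 * π / 9) (π / 9) 0
  -- Reading √3/2 as sin(3π/9) puts every term on the grid of ninths.
  rw [← sin_pi_div_three, show π / 3 = 3 * π / 9 by ring] at *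
  refine ⟨?_, ?_, ?_, ?_, ?_, ?_, ?_, ?_, ?_⟩ <;> rw [← sin_sub_sin_two_mul]
  · rw [sub_self, sin_zero, sub_zero]
    ring_nf
  · rw [show 2 * π / 9 + π / 9 = 3 * π / 9 by ring, show 2 * π / 9 - π / 9 = π / 9 by ring]
  · rw [show 4 * π / 9 + π / 9 = 5 * π / 9 by ring, show 4 * π / 9 - π / 9 = 3 * π / 9 by ring, h₅.2]
  · rw [show π / 9 + 2 * π / 9 = 3 * π / 9 by ring, show π / 9 - 2 * π / 9 = -(π / 9) by ring,
      sin_neg, sub_neg_eq_add]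
  · rw [sub_self, sin_zero, sub_zero]
    ring_nf
  · rw [show 4 * π / 9 + 2 * π / 9 = 6 * π / 9 by ring,
      show 4 * π / 9 - 2 * π / 9 = 2 * π / 9 by ring, h₆.2]
  · rw [show π / 9 + 4 * π / 9 = 5 * π / 9 by ring, show π / 9 - 4 * π / 9 = -(3 * π / 9) by ring,
      sin_neg, sub_neg_eq_add, h₅.2]
  · rw [show 2 * π / 9 + 4 * π / 9 = 6 * π / 9 by ring,
      show 2 * π / 9 - 4 * π / 9 = -(2 * π / 9) by ring, sin_neg, sub_neg_eq_add, h₆.2]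
  · rw [show 4 * π / 9 + 4 * π / 9 = 8 * π / 9 by ring, sub_self, sin_zero, sub_zero, h₈.2]

theorem csc_mul_sin_ninths :
    csc (π / 9) * sin (π / 9) = 1 ∧ csc (2 * π / 9) * sin (2 * π / 9) = 1 ∧
    csc (4 * π / 9) * sin (4 * π / 9) = 1 ∧
    csc (π / 9) * sin (2 * π / 9) = 2 * cos (π / 9) ∧
    csc (2 * π / 9) * sin (4 * π / 9) = 2 * cos (2 * π / 9) ∧
    csc (4 * π / 9) * sin (π / 9) = 2 * cos (4 * π / 9) ∧
    csc (π / 9) * sin (4 * π / 9) = 1 + 2 * cos (2 * π / 9) + 2 * cos (4 * π / 9) ∧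
    csc (2 * π / 9) * sin (π / 9) = 2 * cos (π / 9) - 2 * cos (4 * π / 9) - 1 ∧
    csc (4 * π / 9) * sin (2 * π / 9) = 1 - 2 * cos (π / 9) + 2 * cos (2 * π / 9) ∧
    csc (π / 9) * (√3 / 2) = 1 + 2 * cos (2 * π / 9) ∧
    csc (2 * π / 9) * (√3 / 2) = 1 + 2 * cos (4 * π / 9) ∧
    csc (4 * π / 9) * (√3 / 2) = 2 * cos (π / 9) - 1 := by
  obtain ⟨h₁₁, h₁₂, h₁₄, h₂₁, h₂₂, h₂₄, h₄₁, h₄₂, h₄₄⟩ := sin_mul_cos_ninths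
  refine ⟨csc_mul_sin, csc_mul_sin, csc_mul_sin, csc_mul_eq ?_, csc_mul_eq ?_, csc_mul_eq ?_,
    csc_mul_eq ?_, csc_mul_eq ?_, csc_mul_eq ?_, csc_mul_eq ?_, csc_mul_eq ?_, csc_mul_eq ?_⟩
  · linear_combination -h₁₁
  · linear_combination -h₂₂
  · linear_combination -h₄₄
  · linear_combination -h₁₂ - h₁₄
  · linear_combination h₂₄ - h₂₁
  · linear_combination h₄₁ - h₄₂
  · linear_combination -h₁₂
  · linear_combination -h₂₄
  · linear_combination -h₄₁

end SpecialValues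

/-! ### Zeros of the closed forms in the central window -/

section Zeros

theorem V2_1_half_eq_zero : V2 (1 / 2) = 0 := by
  simp only [V2, trig_add_even (π * (1 / 2)) (π / 2) 0, sin_pi_div_two]
  ring

theorem V3_0_eq_zero : V3 0 = 0 := by
  simp only [V3, mul_zero, zero_div, cos_zero]
  ring

theorem V3_1_eq_zero : V3 1 = 0 := by
  simp only [V3, trig_add_odd (π * 1) 0 0, trig_neg_odd (2 * π * 1 / 3) (π / 3) 0, cos_zero,
    cos_pi_div_three, mul_neg]
  ring

theorem V4_0_eq_zero : V4 0 = 0 := by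
  simp only [V4, mul_zero, zero_div, cos_zero, sin_zero]
  ring

theorem V4_1_eq_zero : V4 1 = 0 := by
  simp only [V4, trig_add_odd (π * 1) 0 0, trig_add_even (π * 1 / 2) (π / 2) 0,
    trig_neg_odd (2 * π * 1 / 3) (π / 3) 0, cos_zero, sin_pi_div_three, sin_pi_div_two,
    div_mul_sqrt_three_mul, mul_neg]
  ring

theorem V4_2_eq_zero : V4 2 = 0 := by
  simp only [V4, trig_add_even (π * 2) 0 1, trig_add_odd (π * 2 / 2) 0 0,
    trig_add_odd (2 * π * 2 / 3) (π / 3) 0, cos_zero, sin_zero, sin_pi_div_three,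
    div_mul_sqrt_three_mul, mul_neg, mul_zero]
  ring

theorem V5_1_half_eq_zero : V5 (1 / 2) = 0 := by
  simp only [V5, trig_add_even (π * (1 / 2)) (π / 2) 0,
    trig_add_even (2 * π * (1 / 2) / 3) (π / 3) 0, trig_add_even (π * (1 / 2) / 2) (π / 4) 0,
    trig_add_even (2 * π * (1 / 2) / 5) (π / 5) 0,
    trig_add_even (4 * π * (1 / 2) / 5) (2 * π / 5) 0, cos_pi_div_five, cos_pi_div_four,
    cos_pi_div_three, cos_two_pi_div_five, sin_pi_div_two, div_mul_sqrt_two_mul]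
  ring

theorem V5_3_half_eq_zero : V5 (3 / 2) = 0 := by
  simp only [V5, trig_add_odd (π * (3 / 2)) (π / 2) 0, trig_add_odd (2 * π * (3 / 2) / 3) 0 0,
    trig_neg_odd (π * (3 / 2) / 2) (π / 4) 0, trig_neg_odd (2 * π * (3 / 2) / 5) (2 * π / 5) 0,
    trig_add_odd (4 * π * (3 / 2) / 5) (π / 5) 0, cos_zero, cos_pi_div_five, cos_pi_div_four,
    cos_two_pi_div_five, sin_pi_div_two, div_mul_sqrt_two_mul, mul_neg, neg_neg]
  ring

theorem V5_5_half_eq_zero : V5 (5 / 2) = 0 := by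
  simp only [V5, trig_add_even (π * (5 / 2)) (π / 2) 1,
    trig_neg_even (2 * π * (5 / 2) / 3) (π / 3) 1, trig_add_odd (π * (5 / 2) / 2) (π / 4) 0,
    trig_add_odd (2 * π * (5 / 2) / 5) 0 0, trig_add_even (4 * π * (5 / 2) / 5) 0 1, cos_zero,
    cos_pi_div_four, cos_pi_div_three, sin_pi_div_two, div_mul_sqrt_two_mul, mul_neg, neg_neg]
  ring

theorem V6_1_half_eq_zero : V6 (1 / 2) = 0 := by
  have h₅ : √5 * √5 = 5 := mul_self_sqrt (by norm_num)
  simp only [V6, trig_add_even (π * (1 / 2)) (π / 2) 0,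
    trig_add_even (2 * π * (1 / 2) / 3) (π / 3) 0, trig_add_even (π * (1 / 2) / 2) (π / 4) 0,
    trig_add_even (π * (1 / 2) / 3) (π / 6) 0, trig_add_even (4 * π * (1 / 2) / 5) (2 * π / 5) 0,
    trig_add_even (2 * π * (1 / 2) / 5) (π / 5) 0, sin_pi_div_six, sin_pi_div_four,
    cos_pi_div_three, sin_pi_div_three, sin_pi_div_two, div_mul_sqrt_two_mul,
    div_mul_sqrt_three_mul, div_mul_sqrt_five, sin_pi_div_five_mul_sin_two_pi_div_five,
    sin_two_pi_div_five_mul_sin_pi_div_five]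
  linear_combination 2 / 125 * h₅

theorem V6_3_half_eq_zero : V6 (3 / 2) = 0 := by
  have h₅ : √5 * √5 = 5 := mul_self_sqrt (by norm_num)
  simp only [V6, trig_add_odd (π * (3 / 2)) (π / 2) 0, trig_add_odd (2 * π * (3 / 2) / 3) 0 0,
    trig_neg_odd (π * (3 / 2) / 2) (π / 4) 0, trig_add_even (π * (3 / 2) / 3) (π / 2) 0,
    trig_add_odd (4 * π * (3 / 2) / 5) (π / 5) 0,
    trig_neg_odd (2 * π * (3 / 2) / 5) (2 * π / 5) 0, cos_zero, sin_zero, sin_pi_div_four,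
    sin_pi_div_two, div_mul_sqrt_two_mul, div_mul_sqrt_five, sin_pi_div_five_mul_self,
    sin_two_pi_div_five_mul_self, mul_neg, mul_zero]
  linear_combination 1 / 125 * h₅

theorem V6_5_half_eq_zero : V6 (5 / 2) = 0 := by
  simp only [V6, trig_add_even (π * (5 / 2)) (π / 2) 1,
    trig_neg_even (2 * π * (5 / 2) / 3) (π / 3) 1, trig_add_odd (π * (5 / 2) / 2) (π / 4) 0,
    trig_neg_odd (π * (5 / 2) / 3) (π / 6) 0, trig_add_even (4 * π * (5 / 2) / 5) 0 1,
    trig_add_odd (2 * π * (5 / 2) / 5) 0 0, sin_zero, sin_pi_div_six, sin_pi_div_four,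
    cos_pi_div_three, sin_pi_div_three, sin_pi_div_two, div_mul_sqrt_two_mul,
    div_mul_sqrt_three_mul, div_mul_sqrt_five, mul_neg, mul_zero]
  ring

theorem V7_0_eq_zero : V7 0 = 0 := by
  simp only [V7, mul_zero, zero_div, cos_zero, sin_zero]
  ring

theorem V7_1_eq_zero : V7 1 = 0 := by
  have h₅ : √5 * √5 = 5 := mul_self_sqrt (by norm_num)
  simp only [V7, trig_add_odd (π * 1) 0 0, trig_neg_odd (2 * π * 1 / 3) (π / 3) 0,
    trig_add_even (π * 1 / 2) (π / 2) 0, trig_add_even (π * 1 / 3) (π / 3) 0,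
    trig_add_even (2 * π * 1 / 5) (2 * π / 5) 0, trig_neg_odd (4 * π * 1 / 5) (π / 5) 0,
    trig_add_even (2 * π * 1 / 7) (2 * π / 7) 0, trig_neg_odd (4 * π * 1 / 7) (3 * π / 7) 0,
    trig_neg_odd (6 * π * 1 / 7) (π / 7) 0, cos_zero, cos_pi_div_five, cos_pi_div_three,
    sin_pi_div_three, cos_two_pi_div_five, cos_pi_div_two, div_mul_sqrt_three_mul,
    div_mul_sqrt_five, cos_three_pi_div_seven, mul_neg, mul_zero]
  linear_combination 1 / 125 * h₅

theorem V7_2_eq_zero : V7 2 = 0 := by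
  have h₅ : √5 * √5 = 5 := mul_self_sqrt (by norm_num)
  simp only [V7, trig_add_even (π * 2) 0 1, trig_add_odd (2 * π * 2 / 3) (π / 3) 0,
    trig_add_odd (π * 2 / 2) 0 0, trig_neg_odd (π * 2 / 3) (π / 3) 0,
    trig_neg_odd (2 * π * 2 / 5) (π / 5) 0, trig_neg_even (4 * π * 2 / 5) (2 * π / 5) 1,
    trig_neg_odd (2 * π * 2 / 7) (3 * π / 7) 0, trig_add_odd (4 * π * 2 / 7) (π / 7) 0,
    trig_neg_even (6 * π * 2 / 7) (2 * π / 7) 1, cos_zero, cos_pi_div_five, cos_pi_div_three,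
    sin_pi_div_three, cos_two_pi_div_five, div_mul_sqrt_three_mul, div_mul_sqrt_five,
    cos_three_pi_div_seven, mul_neg]
  linear_combination -1 / 125 * h₅

theorem V7_3_eq_zero : V7 3 = 0 := by
  have h₅ : √5 * √5 = 5 := mul_self_sqrt (by norm_num)
  simp only [V7, trig_add_odd (π * 3) 0 1, trig_add_even (2 * π * 3 / 3) 0 1,
    trig_add_odd (π * 3 / 2) (π / 2) 0, trig_add_odd (π * 3 / 3) 0 0,
    trig_add_odd (2 * π * 3 / 5) (π / 5) 0, trig_add_even (4 * π * 3 / 5) (2 * π / 5) 1,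
    trig_neg_odd (2 * π * 3 / 7) (π / 7) 0, trig_neg_even (4 * π * 3 / 7) (2 * π / 7) 1,
    trig_neg_odd (6 * π * 3 / 7) (3 * π / 7) 1, cos_zero, sin_zero, cos_pi_div_five,
    cos_two_pi_div_five, cos_pi_div_two, div_mul_sqrt_five, cos_three_pi_div_seven, mul_neg,
    mul_zero]
  linear_combination -1 / 125 * h₅

theorem V8_0_eq_zero : V8 0 = 0 := by
  simp only [V8, mul_zero, zero_div, cos_zero, sin_zero]
  ring

theorem V8_1_eq_zero : V8 1 = 0 := by
  simp only [V8, trig_add_odd (π * 1) 0 0, trig_add_even (π * 1 / 2) (π / 2) 0,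
    trig_neg_odd (2 * π * 1 / 3) (π / 3) 0, trig_add_even (π * 1 / 4) (π / 4) 0,
    trig_neg_odd (3 * π * 1 / 4) (π / 4) 0, trig_add_even (π * 1 / 3) (π / 3) 0,
    trig_neg_odd (4 * π * 1 / 5) (π / 5) 0, trig_add_even (2 * π * 1 / 5) (2 * π / 5) 0,
    trig_add_even (2 * π * 1 / 7) (2 * π / 7) 0, trig_neg_odd (4 * π * 1 / 7) (3 * π / 7) 0,
    trig_neg_odd (6 * π * 1 / 7) (π / 7) 0, cos_zero, sin_pi_div_four, cos_pi_div_three,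
    sin_pi_div_three, cos_pi_div_two, sin_pi_div_two, div_mul_sqrt_three_mul,
    sin_pi_div_five_mul_sin_two_pi_div_five, sin_two_pi_div_five_mul_sin_pi_div_five,
    cos_three_pi_div_seven, csc_mul_sin_sevenths, mul_comm (sin _) (csc _), mul_neg, mul_zero]
  ring

theorem V8_2_eq_zero : V8 2 = 0 := by
  simp only [V8, trig_add_even (π * 2) 0 1, trig_add_odd (π * 2 / 2) 0 0,
    trig_add_odd (2 * π * 2 / 3) (π / 3) 0, trig_add_even (π * 2 / 4) (π / 2) 0,
    trig_add_odd (3 * π * 2 / 4) (π / 2) 0, trig_neg_odd (π * 2 / 3) (π / 3) 0,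
    trig_neg_even (4 * π * 2 / 5) (2 * π / 5) 1, trig_neg_odd (2 * π * 2 / 5) (π / 5) 0,
    trig_neg_odd (2 * π * 2 / 7) (3 * π / 7) 0, trig_add_odd (4 * π * 2 / 7) (π / 7) 0,
    trig_neg_even (6 * π * 2 / 7) (2 * π / 7) 1, cos_zero, sin_zero, cos_pi_div_three,
    sin_pi_div_three, sin_pi_div_two, div_mul_sqrt_three_mul, sin_pi_div_five_mul_self,
    sin_two_pi_div_five_mul_self, cos_three_pi_div_seven, csc_mul_sin_sevenths,
    mul_comm (sin _) (csc _), mul_neg, neg_mul, mul_zero]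
  ring

theorem V8_3_eq_zero : V8 3 = 0 := by
  simp only [V8, trig_add_odd (π * 3) 0 1, trig_add_odd (π * 3 / 2) (π / 2) 0,
    trig_add_even (2 * π * 3 / 3) 0 1, trig_neg_odd (π * 3 / 4) (π / 4) 0,
    trig_add_even (3 * π * 3 / 4) (π / 4) 1, trig_add_odd (π * 3 / 3) 0 0,
    trig_add_even (4 * π * 3 / 5) (2 * π / 5) 1, trig_add_odd (2 * π * 3 / 5) (π / 5) 0,
    trig_neg_odd (2 * π * 3 / 7) (π / 7) 0, trig_neg_even (4 * π * 3 / 7) (2 * π / 7) 1,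
    trig_neg_odd (6 * π * 3 / 7) (3 * π / 7) 1, cos_zero, sin_zero, sin_pi_div_four,
    cos_pi_div_two, sin_pi_div_two, sin_pi_div_five_mul_self, sin_two_pi_div_five_mul_self,
    csc_mul_sin_sevenths, mul_comm (sin _) (csc _), mul_neg, neg_mul, mul_zero]
  ring

theorem V8_4_eq_zero : V8 4 = 0 := by
  simp only [V8, trig_add_even (π * 4) 0 2, trig_add_even (π * 4 / 2) 0 1,
    trig_neg_odd (2 * π * 4 / 3) (π / 3) 1, trig_add_odd (π * 4 / 4) 0 0,
    trig_add_odd (3 * π * 4 / 4) 0 1, trig_add_odd (π * 4 / 3) (π / 3) 0,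
    trig_add_odd (4 * π * 4 / 5) (π / 5) 1, trig_neg_even (2 * π * 4 / 5) (2 * π / 5) 1,
    trig_add_odd (2 * π * 4 / 7) (π / 7) 0, trig_add_even (4 * π * 4 / 7) (2 * π / 7) 1,
    trig_add_odd (6 * π * 4 / 7) (3 * π / 7) 1, cos_zero, sin_zero, cos_pi_div_three,
    sin_pi_div_three, div_mul_sqrt_three_mul, sin_pi_div_five_mul_sin_two_pi_div_five,
    sin_two_pi_div_five_mul_sin_pi_div_five, csc_mul_sin_sevenths, mul_comm (sin _) (csc _),
    mul_neg, neg_mul, mul_zero]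
  ring

theorem V9_1_half_eq_zero : V9 (1 / 2) = 0 := by
  obtain ⟨-, h₁₂, -, -, -, h₂₃, h₃₁, -⟩ := sin_mul_cos_sevenths
  rw [V9, cos_mul_csc_mul_csc_sevenths]
  simp only [trig_add_even (π * (1 / 2)) (π / 2) 0, trig_add_even (2 * π * (1 / 2) / 3) (π / 3) 0,
    trig_add_even (π * (1 / 2) / 2) (π / 4) 0, trig_add_even (π * (1 / 2) / 4) (π / 8) 0,
    trig_add_even (3 * π * (1 / 2) / 4) (3 * π / 8) 0,
    trig_add_even (4 * π * (1 / 2) / 5) (2 * π / 5) 0,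
    trig_add_even (2 * π * (1 / 2) / 5) (π / 5) 0, trig_add_even (π * (1 / 2) / 3) (π / 6) 0,
    trig_add_even (2 * π * (1 / 2) / 9) (π / 9) 0,
    trig_add_even (4 * π * (1 / 2) / 9) (2 * π / 9) 0,
    trig_add_even (8 * π * (1 / 2) / 9) (4 * π / 9) 0,
    trig_add_even (2 * π * (1 / 2) / 7) (π / 7) 0,
    trig_add_even (4 * π * (1 / 2) / 7) (2 * π / 7) 0,
    trig_add_even (6 * π * (1 / 2) / 7) (3 * π / 7) 0, cos_pi_div_nine, cos_pi_div_six,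
    cos_pi_div_five, cos_pi_div_four, sin_pi_div_four, cos_pi_div_three, sin_pi_div_three,
    cos_two_pi_div_five, sin_pi_div_two, div_mul_sqrt_two_mul, div_mul_sqrt_three_mul,
    csc_mul_eighths, mul_comm (cos _) (csc _)]
  -- The three products add up to 2(sin(3π/7) + sin(2π/7) - sin(π/7)), which the triple-cosecant
  -- identity evaluates.
  linear_combination -(csc (π / 7) * csc (2 * π / 7) * csc (3 * π / 7)) / 196 * (h₃₁ + h₁₂ + h₂₃) -
    csc_mul_csc_mul_csc_sevenths / 98

theorem V9_3_half_eq_zero : V9 (3 / 2) = 0 := by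
  obtain ⟨h₁₁, -, -, -, h₂₂, -, -, -, h₃₃⟩ := sin_mul_cos_sevenths
  rw [V9, cos_mul_csc_mul_csc_sevenths]
  simp only [trig_add_odd (π * (3 / 2)) (π / 2) 0, trig_add_odd (2 * π * (3 / 2) / 3) 0 0,
    trig_neg_odd (π * (3 / 2) / 2) (π / 4) 0, trig_add_even (π * (3 / 2) / 4) (3 * π / 8) 0,
    trig_add_odd (3 * π * (3 / 2) / 4) (π / 8) 0, trig_add_odd (4 * π * (3 / 2) / 5) (π / 5) 0,
    trig_neg_odd (2 * π * (3 / 2) / 5) (2 * π / 5) 0, trig_add_even (π * (3 / 2) / 3) (π / 2) 0,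
    trig_add_even (2 * π * (3 / 2) / 9) (π / 3) 0, trig_neg_odd (4 * π * (3 / 2) / 9) (π / 3) 0,
    trig_add_odd (8 * π * (3 / 2) / 9) (π / 3) 0,
    trig_add_even (2 * π * (3 / 2) / 7) (3 * π / 7) 0,
    trig_neg_odd (4 * π * (3 / 2) / 7) (π / 7) 0,
    trig_add_odd (6 * π * (3 / 2) / 7) (2 * π / 7) 0, cos_zero, sin_zero, cos_pi_div_five,
    cos_pi_div_four, sin_pi_div_four, cos_pi_div_three, cos_two_pi_div_five, cos_pi_div_two,
    sin_pi_div_two, div_mul_sqrt_two_mul, csc_mul_eighths, mul_comm (cos _) (csc _), mul_neg,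
    neg_mul, mul_zero]
  linear_combination -(csc (π / 7) * csc (2 * π / 7) * csc (3 * π / 7)) / 196 * (h₃₃ - h₁₁ - h₂₂) +
    csc_mul_csc_mul_csc_sevenths / 196

theorem V9_5_half_eq_zero : V9 (5 / 2) = 0 := by
  obtain ⟨-, -, h₁₃, h₂₁, -, -, -, h₃₂, -⟩ := sin_mul_cos_sevenths
  rw [V9, cos_mul_csc_mul_csc_sevenths]
  simp only [trig_add_even (π * (5 / 2)) (π / 2) 1, trig_neg_even (2 * π * (5 / 2) / 3) (π / 3) 1,
    trig_add_odd (π * (5 / 2) / 2) (π / 4) 0, trig_neg_odd (π * (5 / 2) / 4) (3 * π / 8) 0,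
    trig_neg_even (3 * π * (5 / 2) / 4) (π / 8) 1, trig_add_even (4 * π * (5 / 2) / 5) 0 1,
    trig_add_odd (2 * π * (5 / 2) / 5) 0 0, trig_neg_odd (π * (5 / 2) / 3) (π / 6) 0,
    trig_neg_odd (2 * π * (5 / 2) / 9) (4 * π / 9) 0,
    trig_add_odd (4 * π * (5 / 2) / 9) (π / 9) 0,
    trig_add_even (8 * π * (5 / 2) / 9) (2 * π / 9) 1,
    trig_neg_odd (2 * π * (5 / 2) / 7) (2 * π / 7) 0,
    trig_add_odd (4 * π * (5 / 2) / 7) (3 * π / 7) 0,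
    trig_add_even (6 * π * (5 / 2) / 7) (π / 7) 1, cos_zero, cos_pi_div_nine, cos_pi_div_six,
    cos_pi_div_four, sin_pi_div_four, cos_pi_div_three, sin_pi_div_three, sin_pi_div_two,
    div_mul_sqrt_two_mul, div_mul_sqrt_three_mul, csc_mul_eighths, mul_comm (cos _) (csc _),
    mul_neg, neg_mul, neg_neg]
  -- Here the three products cancel completely, so the sevenths contribute nothing.
  linear_combination -(csc (π / 7) * csc (2 * π / 7) * csc (3 * π / 7)) / 196 * (h₂₁ - h₁₃ - h₃₂)

theorem V9_7_half_eq_zero : V9 (7 / 2) = 0 := by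
  rw [V9, cos_mul_csc_mul_csc_sevenths]
  simp only [trig_add_odd (π * (7 / 2)) (π / 2) 1, trig_add_even (2 * π * (7 / 2) / 3) (π / 3) 1,
    trig_neg_even (π * (7 / 2) / 2) (π / 4) 1, trig_neg_odd (π * (7 / 2) / 4) (π / 8) 0,
    trig_neg_odd (3 * π * (7 / 2) / 4) (3 * π / 8) 1,
    trig_neg_odd (4 * π * (7 / 2) / 5) (π / 5) 1,
    trig_add_odd (2 * π * (7 / 2) / 5) (2 * π / 5) 0, trig_add_odd (π * (7 / 2) / 3) (π / 6) 0,
    trig_neg_odd (2 * π * (7 / 2) / 9) (2 * π / 9) 0,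
    trig_neg_even (4 * π * (7 / 2) / 9) (4 * π / 9) 1,
    trig_add_odd (8 * π * (7 / 2) / 9) (π / 9) 1, trig_add_odd (2 * π * (7 / 2) / 7) 0 0,
    trig_add_even (4 * π * (7 / 2) / 7) 0 1, trig_add_odd (6 * π * (7 / 2) / 7) 0 1, cos_zero,
    cos_pi_div_nine, cos_pi_div_six, cos_pi_div_five, cos_pi_div_four, sin_pi_div_four,
    cos_pi_div_three, sin_pi_div_three, cos_two_pi_div_five, sin_pi_div_two, div_mul_sqrt_two_mul,
    div_mul_sqrt_three_mul, csc_mul_eighths, mul_comm (cos _) (csc _), mul_neg, neg_mul, neg_neg]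
  linear_combination csc_mul_csc_mul_csc_sevenths / 98

theorem V9_9_half_eq_zero : V9 (9 / 2) = 0 := by
  obtain ⟨-, -, h₁₃, h₂₁, -, -, -, h₃₂, -⟩ := sin_mul_cos_sevenths
  rw [V9, cos_mul_csc_mul_csc_sevenths]
  simp only [trig_add_even (π * (9 / 2)) (π / 2) 2, trig_add_odd (2 * π * (9 / 2) / 3) 0 1,
    trig_add_even (π * (9 / 2) / 2) (π / 4) 1, trig_add_odd (π * (9 / 2) / 4) (π / 8) 0,
    trig_add_odd (3 * π * (9 / 2) / 4) (3 * π / 8) 1,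
    trig_neg_even (4 * π * (9 / 2) / 5) (2 * π / 5) 2,
    trig_neg_even (2 * π * (9 / 2) / 5) (π / 5) 1, trig_add_odd (π * (9 / 2) / 3) (π / 2) 0,
    trig_add_odd (2 * π * (9 / 2) / 9) 0 0, trig_add_even (4 * π * (9 / 2) / 9) 0 1,
    trig_add_even (8 * π * (9 / 2) / 9) 0 2, trig_add_odd (2 * π * (9 / 2) / 7) (2 * π / 7) 0,
    trig_neg_odd (4 * π * (9 / 2) / 7) (3 * π / 7) 1,
    trig_neg_even (6 * π * (9 / 2) / 7) (π / 7) 2, cos_zero, sin_zero, cos_pi_div_five,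
    cos_pi_div_four, sin_pi_div_four, cos_two_pi_div_five, cos_pi_div_two, sin_pi_div_two,
    div_mul_sqrt_two_mul, csc_mul_eighths, mul_comm (cos _) (csc _), mul_neg, neg_mul, neg_neg,
    mul_zero]
  linear_combination -(csc (π / 7) * csc (2 * π / 7) * csc (3 * π / 7)) / 196 * (h₂₁ - h₁₃ - h₃₂)

theorem V10_1_half_eq_zero : V10 (1 / 2) = 0 := by
  have h₅ : √5 * √5 = 5 := mul_self_sqrt (by norm_num)
  rw [V10, sqrt_two_mul_radicals]
  simp only [trig_add_even (π * (1 / 2)) (π / 2) 0, trig_add_even (2 * π * (1 / 2) / 3) (π / 3) 0,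
    trig_add_even (π * (1 / 2) / 2) (π / 4) 0, trig_add_even (4 * π * (1 / 2) / 5) (2 * π / 5) 0,
    trig_add_even (2 * π * (1 / 2) / 5) (π / 5) 0, trig_add_even (π * (1 / 2) / 3) (π / 6) 0,
    trig_add_even (3 * π * (1 / 2) / 4) (3 * π / 8) 0, trig_add_even (π * (1 / 2) / 4) (π / 8) 0,
    trig_add_even (3 * π * (1 / 2) / 5) (3 * π / 10) 0,
    trig_add_even (π * (1 / 2) / 5) (π / 10) 0, trig_add_even (6 * π * (1 / 2) / 7) (3 * π / 7) 0,
    trig_add_even (4 * π * (1 / 2) / 7) (2 * π / 7) 0,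
    trig_add_even (2 * π * (1 / 2) / 7) (π / 7) 0,
    trig_add_even (8 * π * (1 / 2) / 9) (4 * π / 9) 0,
    trig_add_even (4 * π * (1 / 2) / 9) (2 * π / 9) 0,
    trig_add_even (2 * π * (1 / 2) / 9) (π / 9) 0, sin_pi_div_ten, sin_pi_div_six,
    cos_pi_div_five, cos_pi_div_four, sin_pi_div_four, sin_three_pi_div_ten, cos_pi_div_three,
    sin_pi_div_three, cos_two_pi_div_five, sin_pi_div_two, div_mul_sqrt_two_mul,
    div_mul_sqrt_three_mul, csc_mul_eighths, csc_mul_sin_ninths, csc_mul_sin_fifths]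
  linear_combination -1 / 196 * csc_mul_csc_mul_csc_sevenths - 1 / 625 * h₅

theorem V10_3_half_eq_zero : V10 (3 / 2) = 0 := by
  -- The eighths contribute -(√2 - 1) - (1 + √2) = -2√2, to be divided by 64√2.
  have h₂ : √2 / √2 = 1 := div_self (by positivity)
  rw [V10, sqrt_two_mul_radicals]
  simp only [trig_add_odd (π * (3 / 2)) (π / 2) 0, trig_add_odd (2 * π * (3 / 2) / 3) 0 0,
    trig_neg_odd (π * (3 / 2) / 2) (π / 4) 0, trig_add_odd (4 * π * (3 / 2) / 5) (π / 5) 0,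
    trig_neg_odd (2 * π * (3 / 2) / 5) (2 * π / 5) 0, trig_add_even (π * (3 / 2) / 3) (π / 2) 0,
    trig_add_odd (3 * π * (3 / 2) / 4) (π / 8) 0, trig_add_even (π * (3 / 2) / 4) (3 * π / 8) 0,
    trig_neg_odd (3 * π * (3 / 2) / 5) (π / 10) 0, trig_add_even (π * (3 / 2) / 5) (3 * π / 10) 0,
    trig_add_odd (6 * π * (3 / 2) / 7) (2 * π / 7) 0,
    trig_neg_odd (4 * π * (3 / 2) / 7) (π / 7) 0,
    trig_add_even (2 * π * (3 / 2) / 7) (3 * π / 7) 0,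
    trig_add_odd (8 * π * (3 / 2) / 9) (π / 3) 0, trig_neg_odd (4 * π * (3 / 2) / 9) (π / 3) 0,
    trig_add_even (2 * π * (3 / 2) / 9) (π / 3) 0, cos_zero, sin_zero, sin_pi_div_ten,
    cos_pi_div_five, cos_pi_div_four, sin_pi_div_four, sin_three_pi_div_ten, sin_pi_div_three,
    cos_two_pi_div_five, sin_pi_div_two, div_mul_sqrt_two_mul, csc_mul_eighths,
    csc_mul_sin_ninths, cos_pi_div_nine, csc_mul_sin_fifths, mul_neg, mul_zero]
  linear_combination 1 / 196 * csc_mul_csc_mul_csc_sevenths - 1 / 32 * h₂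

theorem V10_5_half_eq_zero : V10 (5 / 2) = 0 := by
  have h₂ : √2 / √2 = 1 := div_self (by positivity)
  rw [V10, sqrt_two_mul_radicals]
  simp only [trig_add_even (π * (5 / 2)) (π / 2) 1, trig_neg_even (2 * π * (5 / 2) / 3) (π / 3) 1,
    trig_add_odd (π * (5 / 2) / 2) (π / 4) 0, trig_add_even (4 * π * (5 / 2) / 5) 0 1,
    trig_add_odd (2 * π * (5 / 2) / 5) 0 0, trig_neg_odd (π * (5 / 2) / 3) (π / 6) 0,
    trig_neg_even (3 * π * (5 / 2) / 4) (π / 8) 1, trig_neg_odd (π * (5 / 2) / 4) (3 * π / 8) 0,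
    trig_add_odd (3 * π * (5 / 2) / 5) (π / 2) 0, trig_add_even (π * (5 / 2) / 5) (π / 2) 0,
    trig_add_even (6 * π * (5 / 2) / 7) (π / 7) 1,
    trig_add_odd (4 * π * (5 / 2) / 7) (3 * π / 7) 0,
    trig_neg_odd (2 * π * (5 / 2) / 7) (2 * π / 7) 0,
    trig_add_even (8 * π * (5 / 2) / 9) (2 * π / 9) 1,
    trig_add_odd (4 * π * (5 / 2) / 9) (π / 9) 0,
    trig_neg_odd (2 * π * (5 / 2) / 9) (4 * π / 9) 0, cos_zero, sin_zero, cos_pi_div_nine,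
    sin_pi_div_six, cos_pi_div_four, sin_pi_div_four, cos_pi_div_three, sin_pi_div_three,
    sin_pi_div_two, div_mul_sqrt_two_mul, div_mul_sqrt_three_mul, csc_mul_eighths,
    csc_mul_sin_ninths, cos_pi_div_nine, mul_neg, mul_zero]
  linear_combination 1 / 196 * csc_mul_csc_mul_csc_sevenths - 1 / 32 * h₂

theorem V10_7_half_eq_zero : V10 (7 / 2) = 0 := by
  rw [V10, sqrt_two_mul_radicals]
  simp only [trig_add_odd (π * (7 / 2)) (π / 2) 1, trig_add_even (2 * π * (7 / 2) / 3) (π / 3) 1,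
    trig_neg_even (π * (7 / 2) / 2) (π / 4) 1, trig_neg_odd (4 * π * (7 / 2) / 5) (π / 5) 1,
    trig_add_odd (2 * π * (7 / 2) / 5) (2 * π / 5) 0, trig_add_odd (π * (7 / 2) / 3) (π / 6) 0,
    trig_neg_odd (3 * π * (7 / 2) / 4) (3 * π / 8) 1, trig_neg_odd (π * (7 / 2) / 4) (π / 8) 0,
    trig_add_even (3 * π * (7 / 2) / 5) (π / 10) 1, trig_neg_odd (π * (7 / 2) / 5) (3 * π / 10) 0,
    trig_add_odd (6 * π * (7 / 2) / 7) 0 1, trig_add_even (4 * π * (7 / 2) / 7) 0 1,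
    trig_add_odd (2 * π * (7 / 2) / 7) 0 0, trig_add_odd (8 * π * (7 / 2) / 9) (π / 9) 1,
    trig_neg_even (4 * π * (7 / 2) / 9) (4 * π / 9) 1,
    trig_neg_odd (2 * π * (7 / 2) / 9) (2 * π / 9) 0, sin_zero, sin_pi_div_ten, cos_pi_div_nine,
    sin_pi_div_six, cos_pi_div_five, cos_pi_div_four, sin_pi_div_four, sin_three_pi_div_ten,
    cos_pi_div_three, sin_pi_div_three, cos_two_pi_div_five, sin_pi_div_two, div_mul_sqrt_two_mul,
    div_mul_sqrt_three_mul, csc_mul_eighths, csc_mul_sin_ninths, cos_pi_div_nine,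
    csc_mul_sin_fifths, mul_neg]
  ring

theorem V10_9_half_eq_zero : V10 (9 / 2) = 0 := by
  have h₅ : √5 * √5 = 5 := mul_self_sqrt (by norm_num)
  rw [V10, sqrt_two_mul_radicals]
  simp only [trig_add_even (π * (9 / 2)) (π / 2) 2, trig_add_odd (2 * π * (9 / 2) / 3) 0 1,
    trig_add_even (π * (9 / 2) / 2) (π / 4) 1, trig_neg_even (4 * π * (9 / 2) / 5) (2 * π / 5) 2,
    trig_neg_even (2 * π * (9 / 2) / 5) (π / 5) 1, trig_add_odd (π * (9 / 2) / 3) (π / 2) 0,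
    trig_add_odd (3 * π * (9 / 2) / 4) (3 * π / 8) 1, trig_add_odd (π * (9 / 2) / 4) (π / 8) 0,
    trig_neg_odd (3 * π * (9 / 2) / 5) (3 * π / 10) 1, trig_neg_odd (π * (9 / 2) / 5) (π / 10) 0,
    trig_neg_even (6 * π * (9 / 2) / 7) (π / 7) 2,
    trig_neg_odd (4 * π * (9 / 2) / 7) (3 * π / 7) 1,
    trig_add_odd (2 * π * (9 / 2) / 7) (2 * π / 7) 0, trig_add_even (8 * π * (9 / 2) / 9) 0 2,
    trig_add_even (4 * π * (9 / 2) / 9) 0 1, trig_add_odd (2 * π * (9 / 2) / 9) 0 0, cos_zero,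
    sin_zero, sin_pi_div_ten, cos_pi_div_five, cos_pi_div_four, sin_pi_div_four,
    sin_three_pi_div_ten, cos_two_pi_div_five, sin_pi_div_two, div_mul_sqrt_two_mul,
    csc_mul_eighths, csc_mul_sin_fifths, mul_neg, mul_zero]
  linear_combination -1 / 196 * csc_mul_csc_mul_csc_sevenths + 1 / 625 * h₅

end Zeros

/-! ### Periods of the coefficients -/

section PeriodicCoeffs

/-- A harmonic of angular frequency 2πa/q with q ≤ j turns through a whole number of circles over
lcm(1, …, j), since q divides it. -/
theorem trig_add_lcmUpTo (j : ℕ) (x y : ℝ) (q : ℕ) (a : ℤ) (hq : 1 ≤ q := by norm_num)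
    (hqj : q ≤ j := by norm_num)
    (h : x = y + a * (2 * π / q) * lcmUpTo j := by push_cast; ring) :
    cos x = cos y ∧ sin x = sin y := by
  obtain ⟨k, hk⟩ := dvd_lcmUpTo hq hqj
  refine trig_add_even x y (a * k) ?_
  have hq' : (q : ℝ) ≠ 0 := by positivity
  rw [h, hk]
  push_cast
  field_simp

/-- The harmonics of the closed forms whose period does not exceed `j` have period `lcmUpTo j`. -/
theorem harmonics_add_lcmUpTo (j : ℕ) (s : ℝ) :
    (2 ≤ j → cos (π * (s + lcmUpTo j)) = cos (π * s) ∧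
      sin (π * (s + lcmUpTo j)) = sin (π * s)) ∧
    (3 ≤ j → cos (2 * π * (s + lcmUpTo j) / 3) = cos (2 * π * s / 3) ∧
      sin (2 * π * (s + lcmUpTo j) / 3) = sin (2 * π * s / 3)) ∧
    (4 ≤ j → cos (π * (s + lcmUpTo j) / 2) = cos (π * s / 2) ∧
      sin (π * (s + lcmUpTo j) / 2) = sin (π * s / 2)) ∧
    (5 ≤ j → cos (2 * π * (s + lcmUpTo j) / 5) = cos (2 * π * s / 5) ∧
      sin (2 * π * (s + lcmUpTo j) / 5) = sin (2 * π * s / 5)) ∧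
    (5 ≤ j → cos (4 * π * (s + lcmUpTo j) / 5) = cos (4 * π * s / 5) ∧
      sin (4 * π * (s + lcmUpTo j) / 5) = sin (4 * π * s / 5)) ∧
    (6 ≤ j → cos (π * (s + lcmUpTo j) / 3) = cos (π * s / 3) ∧
      sin (π * (s + lcmUpTo j) / 3) = sin (π * s / 3)) ∧
    (7 ≤ j → cos (2 * π * (s + lcmUpTo j) / 7) = cos (2 * π * s / 7) ∧
      sin (2 * π * (s + lcmUpTo j) / 7) = sin (2 * π * s / 7)) ∧
    (7 ≤ j → cos (4 * π * (s + lcmUpTo j) / 7) = cos (4 * π * s / 7) ∧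
      sin (4 * π * (s + lcmUpTo j) / 7) = sin (4 * π * s / 7)) ∧
    (7 ≤ j → cos (6 * π * (s + lcmUpTo j) / 7) = cos (6 * π * s / 7) ∧
      sin (6 * π * (s + lcmUpTo j) / 7) = sin (6 * π * s / 7)) ∧
    (8 ≤ j → cos (π * (s + lcmUpTo j) / 4) = cos (π * s / 4) ∧
      sin (π * (s + lcmUpTo j) / 4) = sin (π * s / 4)) ∧
    (8 ≤ j → cos (3 * π * (s + lcmUpTo j) / 4) = cos (3 * π * s / 4) ∧
      sin (3 * π * (s + lcmUpTo j) / 4) = sin (3 * π * s / 4)) ∧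
    (9 ≤ j → cos (2 * π * (s + lcmUpTo j) / 9) = cos (2 * π * s / 9) ∧
      sin (2 * π * (s + lcmUpTo j) / 9) = sin (2 * π * s / 9)) ∧
    (9 ≤ j → cos (4 * π * (s + lcmUpTo j) / 9) = cos (4 * π * s / 9) ∧
      sin (4 * π * (s + lcmUpTo j) / 9) = sin (4 * π * s / 9)) ∧
    (9 ≤ j → cos (8 * π * (s + lcmUpTo j) / 9) = cos (8 * π * s / 9) ∧
      sin (8 * π * (s + lcmUpTo j) / 9) = sin (8 * π * s / 9)) ∧
    (10 ≤ j → cos (π * (s + lcmUpTo j) / 5) = cos (π * s / 5) ∧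
      sin (π * (s + lcmUpTo j) / 5) = sin (π * s / 5)) ∧
    (10 ≤ j → cos (3 * π * (s + lcmUpTo j) / 5) = cos (3 * π * s / 5) ∧
      sin (3 * π * (s + lcmUpTo j) / 5) = sin (3 * π * s / 5)) := by
  refine ⟨fun h => trig_add_lcmUpTo j _ _ 2 1 (hqj := h),
    fun h => trig_add_lcmUpTo j _ _ 3 1 (hqj := h),
    fun h => trig_add_lcmUpTo j _ _ 4 1 (hqj := h),
    fun h => trig_add_lcmUpTo j _ _ 5 1 (hqj := h),
    fun h => trig_add_lcmUpTo j _ _ 5 2 (hqj := h),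
    fun h => trig_add_lcmUpTo j _ _ 6 1 (hqj := h),
    fun h => trig_add_lcmUpTo j _ _ 7 1 (hqj := h),
    fun h => trig_add_lcmUpTo j _ _ 7 2 (hqj := h),
    fun h => trig_add_lcmUpTo j _ _ 7 3 (hqj := h),
    fun h => trig_add_lcmUpTo j _ _ 8 1 (hqj := h),
    fun h => trig_add_lcmUpTo j _ _ 8 3 (hqj := h),
    fun h => trig_add_lcmUpTo j _ _ 9 1 (hqj := h),
    fun h => trig_add_lcmUpTo j _ _ 9 2 (hqj := h),
    fun h => trig_add_lcmUpTo j _ _ 9 4 (hqj := h),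
    fun h => trig_add_lcmUpTo j _ _ 10 1 (hqj := h),
    fun h => trig_add_lcmUpTo j _ _ 10 3 (hqj := h)⟩

theorem hasPeriodicCoeffs_V1 : HasPeriodicCoeffs 1 V1 := by
  refine ⟨fun j s => match j with
    | 1 => 1
    | _ => 0, fun j hj s => ?_, fun s => ?_⟩
  · obtain ⟨h₁, h₂⟩ := Finset.mem_Icc.1 hj
    interval_cases j
    simp only
  · simp [V1]

/-- The witnesses for all m are read off by collecting powers of s. They meet the period bound for a
structural reason: a primitive q-th root of unity is a pole of order ⌊m/q⌋ of the generating
function, so its harmonic reaches at most s^(⌊m/q⌋ - 1), which forces j ≥ q. -/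
theorem hasPeriodicCoeffs_V2 : HasPeriodicCoeffs 2 V2 := by
  refine ⟨fun j s => match j with
    | 1 => 1 / 2
    | 2 => -(1 / 4 * sin (π * s))
    | _ => 0, fun j hj s => ?_, fun s => ?_⟩
  · obtain ⟨h₁, h₂⟩ := Finset.mem_Icc.1 hj
    -- `omega` discharges q ≤ j, so a harmonic is rewritten only where its period is allowed.
    interval_cases j <;> simp (disch := omega) only [harmonics_add_lcmUpTo]
  · simp [Finset.sum_Icc_succ_top, V2]
    ring

theorem hasPeriodicCoeffs_V3 : HasPeriodicCoeffs 3 V3 := by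
  refine ⟨fun j s => match j with
    | 1 => 1 / 12
    | 3 => -(7 / 72) - 1 / 8 * cos (π * s) + 2 / 9 * cos (2 * π * s / 3)
    | _ => 0, fun j hj s => ?_, fun s => ?_⟩
  · obtain ⟨h₁, h₂⟩ := Finset.mem_Icc.1 hj
    interval_cases j <;> simp (disch := omega) only [harmonics_add_lcmUpTo]
  · simp [Finset.sum_Icc_succ_top, V3]
    ring

theorem hasPeriodicCoeffs_V4 : HasPeriodicCoeffs 4 V4 := by
  refine ⟨fun j s => match j with
    | 1 => 1 / 144
    | 3 => -(5 + 3 * cos (π * s)) / 96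
    | 4 => 1 / 8 * sin (π * s / 2) - 2 / (9 * √3) * sin (2 * π * s / 3)
    | _ => 0, fun j hj s => ?_, fun s => ?_⟩
  · obtain ⟨h₁, h₂⟩ := Finset.mem_Icc.1 hj
    interval_cases j <;> simp (disch := omega) only [harmonics_add_lcmUpTo]
  · simp [Finset.sum_Icc_succ_top, V4]
    ring

theorem hasPeriodicCoeffs_V5 : HasPeriodicCoeffs 5 V5 := by
  refine ⟨fun j s => match j with
    | 1 => 1 / 2880
    | 3 => -(11 / 1152)
    | 4 => -(sin (π * s) / 64)
    | 5 => 17083 / 691200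
        - 2 / 27 * cos (2 * π * s / 3) + 1 / (8 * √2) * cos (π * s / 2)
        + 2 / 25 * (-cos (2 * π * s / 5) + cos (4 * π * s / 5))
    | _ => 0, fun j hj s => ?_, fun s => ?_⟩
  · obtain ⟨h₁, h₂⟩ := Finset.mem_Icc.1 hj
    interval_cases j <;> simp (disch := omega) only [harmonics_add_lcmUpTo]
  · simp [Finset.sum_Icc_succ_top, V5]
    ring

theorem hasPeriodicCoeffs_V6 : HasPeriodicCoeffs 6 V6 := by
  refine ⟨fun j s => match j with
    | 1 => 1 / 86400
    | 3 => -(91 / 103680)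
    | 4 => 1 / 768 * sin (π * s)
    | 5 => 1 / 829440 * (9191 - 10240 * cos (2 * π * s / 3))
    | 6 => -(161 / 9216 * sin (π * s)) - 1 / (16 * √2) * sin (π * s / 2)
        - 1 / (81 * √3) * sin (2 * π * s / 3) - 1 / 18 * sin (π * s / 3)
        + 4 / (25 * √5) * (sin (π / 5) * sin (4 * π * s / 5) + sin (2 * π / 5) * sin (2 * π * s / 5))
    | _ => 0, fun j hj s => ?_, fun s => ?_⟩
  · obtain ⟨h₁, h₂⟩ := Finset.mem_Icc.1 hj
    interval_cases j <;> simp (disch := omega) only [harmonics_add_lcmUpTo]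
  · simp [Finset.sum_Icc_succ_top, V6]
    ring

theorem hasPeriodicCoeffs_V7 : HasPeriodicCoeffs 7 V7 := by
  refine ⟨fun j s => match j with
    | 1 => 1 / 3628800
    | 3 => -(1 / 20736)
    | 5 => 1 / 38400 * (71 + 25 * cos (π * s))
    | 6 => -(1 / (81 * √3) * sin (2 * π * s / 3))
    | 7 => -(52705 / 6096384) - 77 / 4608 * cos (π * s) - 1 / 32 * cos (π * s / 2)
        - 5 / 486 * cos (2 * π * s / 3) - 1 / 18 * cos (π * s / 3)
        + 2 / (25 * √5) * (cos (2 * π * s / 5) - cos (4 * π * s / 5))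
        + 2 / 49 * (cos (2 * π * s / 7) + cos (4 * π * s / 7) + cos (6 * π * s / 7))
    | _ => 0, fun j hj s => ?_, fun s => ?_⟩
  · obtain ⟨h₁, h₂⟩ := Finset.mem_Icc.1 hj
    interval_cases j <;> simp (disch := omega) only [harmonics_add_lcmUpTo]
  · simp [Finset.sum_Icc_succ_top, V7]
    ring

theorem hasPeriodicCoeffs_V8 : HasPeriodicCoeffs 8 V8 := by
  refine ⟨fun j s => match j with
    | 1 => 1 / 203212800
    | 3 => -(17 / 9676800)
    | 5 => 1 / 8294400 * (1343 + 225 * cos (π * s))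
    | 7 => -(16133 / 4976640) - 1 / 256 * cos (π * s / 2) + 1 / 243 * cos (2 * π * s / 3)
        - 31 / 12288 * cos (π * s)
    | 8 => 1 / 32 * (sin (π * s / 4) - sin (3 * π * s / 4)) - 1 / 128 * sin (π * s / 2)
        + 1 / (162 * √3) * sin (2 * π * s / 3) + 1 / (18 * √3) * sin (π * s / 3)
        + 4 / 125 * (sin (2 * π / 5) * sin (4 * π * s / 5) - sin (π / 5) * sin (2 * π * s / 5))
        - 1 / 49 * (sin (2 * π * s / 7) * csc (π / 7) - sin (4 * π * s / 7) * csc (2 * π / 7)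
        + sin (6 * π * s / 7) * csc (3 * π / 7))
    | _ => 0, fun j hj s => ?_, fun s => ?_⟩
  · obtain ⟨h₁, h₂⟩ := Finset.mem_Icc.1 hj
    interval_cases j <;> simp (disch := omega) only [harmonics_add_lcmUpTo]
  · simp [Finset.sum_Icc_succ_top, V8]
    ring

theorem hasPeriodicCoeffs_V9 : HasPeriodicCoeffs 9 V9 := by
  refine ⟨fun j s => match j with
    | 1 => 1 / 14631321600
    | 3 => -(19 / 418037760)
    | 5 => 145597 / 16721510400
    | 6 => 1 / 73728 * sin (π * s)
    | 7 => -(67293991 / 140460687360 + 1 / 4374 * cos (2 * π * s / 3))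
    | 8 => -(1 / (256 * √2) * sin (π * s / 2) + 1 / (1458 * √3) * sin (2 * π * s / 3)
        + 205 / 98304 * sin (π * s))
    | 9 => 199596951167 / 56184274944000
        + 1 / 64 * (cos (π * s / 4) * csc (π / 8) - cos (3 * π * s / 4) * csc (3 * π / 8))
        + 2 / 125 * (cos (4 * π * s / 5) - cos (2 * π * s / 5))
        - 5 / (512 * √2) * cos (π * s / 2) + 257 / 17496 * cos (2 * π * s / 3)
        + 1 / (36 * √3) * cos (π * s / 3)
        + 2 / 81 * (-cos (2 * π * s / 9) + cos (4 * π * s / 9) + cos (8 * π * s / 9))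
        - 1 / 98 * (cos (2 * π * s / 7) * csc (π / 7) * csc (2 * π / 7)
        + cos (4 * π * s / 7) * csc (2 * π / 7) * csc (3 * π / 7)
        + cos (6 * π * s / 7) * csc (3 * π / 7) * csc (π / 7))
    | _ => 0, fun j hj s => ?_, fun s => ?_⟩
  · obtain ⟨h₁, h₂⟩ := Finset.mem_Icc.1 hj
    interval_cases j <;> simp (disch := omega) only [harmonics_add_lcmUpTo]
  · simp [Finset.sum_Icc_succ_top, V9]
    ring

theorem hasPeriodicCoeffs_V10 : HasPeriodicCoeffs 10 V10 := by
  refine ⟨fun j s => match j with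
    | 1 => 1 / 1316818944000
    | 3 => -(11 / 12541132800)
    | 5 => 113113 / 358318080000
    | 6 => -(sin (π * s) / 2949120)
    | 7 => -(18063859 / 468202291200)
    | 8 => 1 / (4374 * √3) * sin (2 * π * s / 3) + 143 / 1179648 * sin (π * s)
    | 9 => 273512277643 / 240789749760000 + 1 / (512 * √2) * cos (π * s / 2)
        + 7 / 13122 * cos (2 * π * s / 3)
        + 1 / 625 * (cos (4 * π * s / 5) - cos (2 * π * s / 5))
    | 10 => -(2877523 / 707788800 * sin (π * s)) - 1211 / (52488 * √3) * sin (2 * π * s / 3)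
        - 5 / (1024 * √2) * sin (π * s / 2) - 1 / 108 * sin (π * s / 3)
        + 1 / (64 * √2) * (csc (3 * π / 8) * sin (3 * π * s / 4) - csc (π / 8) * sin (π * s / 4))
        + 1 / 50 * (sin (3 * π * s / 5) - sin (π * s / 5))
        - 2 * √2 / 625 * ((√5 + 2) / √(5 + √5) * sin (2 * π * s / 5)
        + (√5 - 2) / √(5 - √5) * sin (4 * π * s / 5))
        - 1 / 196 * csc (π / 7) * csc (2 * π / 7) * csc (3 * π / 7)
        * (sin (6 * π * s / 7) + sin (4 * π * s / 7) - sin (2 * π * s / 7))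
        + 1 / 81 * (csc (4 * π / 9) * sin (8 * π * s / 9) + csc (2 * π / 9) * sin (4 * π * s / 9)
        + csc (π / 9) * sin (2 * π * s / 9))
    | _ => 0, fun j hj s => ?_, fun s => ?_⟩
  · obtain ⟨h₁, h₂⟩ := Finset.mem_Icc.1 hj
    interval_cases j <;> simp (disch := omega) only [harmonics_add_lcmUpTo]
  · simp [Finset.sum_Icc_succ_top, V10]
    ring

end PeriodicCoeffs

/-! ### Parity and the induction on m -/

section Agreement

theorem V2_neg (s : ℝ) : V2 (-s) = -1 * V2 s := by
  simp only [V2, mul_neg, sin_neg]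
  ring

theorem V3_neg (s : ℝ) : V3 (-s) = 1 * V3 s := by
  simp only [V3, mul_neg, neg_div, cos_neg]
  ring

theorem V4_neg (s : ℝ) : V4 (-s) = -1 * V4 s := by
  simp only [V4, mul_neg, neg_div, cos_neg, sin_neg]
  ring

theorem V5_neg (s : ℝ) : V5 (-s) = 1 * V5 s := by
  simp only [V5, mul_neg, neg_div, cos_neg, sin_neg]
  ring

theorem V6_neg (s : ℝ) : V6 (-s) = -1 * V6 s := by
  simp only [V6, mul_neg, neg_div, cos_neg, sin_neg]
  ring

theorem V7_neg (s : ℝ) : V7 (-s) = 1 * V7 s := by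
  simp only [V7, mul_neg, neg_div, cos_neg, sin_neg]
  ring

theorem V8_neg (s : ℝ) : V8 (-s) = -1 * V8 s := by
  simp only [V8, mul_neg, neg_div, cos_neg, sin_neg]
  ring

theorem V9_neg (s : ℝ) : V9 (-s) = 1 * V9 s := by
  simp only [V9, mul_neg, neg_div, cos_neg, sin_neg]
  ring

theorem V10_neg (s : ℝ) : V10 (-s) = -1 * V10 s := by
  simp only [V10, mul_neg, neg_div, cos_neg, sin_neg]
  ring

/-- The strict bound s > -1/2 is sharp: it says n > -1, and at n = -1 the constant 1 differs from
the extended value 0. -/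
theorem agreesWithPartitions_V1 : AgreesWithPartitions 1 V1 := by
  intro n hn
  rw [partitionNumberInt_one, V1]
  have : (-1 : ℝ) < n := by
    norm_num [shift] at hn
    linarith
  have : (-1 : ℤ) < n := by exact_mod_cast this
  omega

theorem agreesWithPartitions_V2 : AgreesWithPartitions 2 V2 := by
  refine agreesWithPartitions_V1.succ (by norm_num) (fun s => ?_)
    (eq_zero_of_abs_le _ V2_neg fun k hk hk' => ?_)
  · norm_num [V2_recurrence]
  · interval_cases k
    all_goals first
      -- Removes the k of the wrong parity, which are not twice an admissible point.
      | exact absurd hk' (by decide)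
      | norm_num [V2_1_half_eq_zero]

theorem agreesWithPartitions_V3 : AgreesWithPartitions 3 V3 := by
  refine agreesWithPartitions_V2.succ (by norm_num) (fun s => ?_)
    (eq_zero_of_abs_le _ V3_neg fun k hk hk' => ?_)
  · norm_num [V3_recurrence]
  · interval_cases k
    all_goals first
      | exact absurd hk' (by decide)
      | norm_num [V3_0_eq_zero, V3_1_eq_zero]

theorem agreesWithPartitions_V4 : AgreesWithPartitions 4 V4 := by
  refine agreesWithPartitions_V3.succ (by norm_num) (fun s => ?_)
    (eq_zero_of_abs_le _ V4_neg fun k hk hk' => ?_)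
  · norm_num [V4_recurrence]
  · interval_cases k
    all_goals first
      | exact absurd hk' (by decide)
      | norm_num [V4_0_eq_zero, V4_1_eq_zero, V4_2_eq_zero]

theorem agreesWithPartitions_V5 : AgreesWithPartitions 5 V5 := by
  refine agreesWithPartitions_V4.succ (by norm_num) (fun s => ?_)
    (eq_zero_of_abs_le _ V5_neg fun k hk hk' => ?_)
  · norm_num [V5_recurrence]
  · interval_cases k
    all_goals first
      | exact absurd hk' (by decide)
      | norm_num [V5_1_half_eq_zero, V5_3_half_eq_zero, V5_5_half_eq_zero]

theorem agreesWithPartitions_V6 : AgreesWithPartitions 6 V6 := by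
  refine agreesWithPartitions_V5.succ (by norm_num) (fun s => ?_)
    (eq_zero_of_abs_le _ V6_neg fun k hk hk' => ?_)
  · norm_num [V6_recurrence]
  · interval_cases k
    all_goals first
      | exact absurd hk' (by decide)
      | norm_num [V6_1_half_eq_zero, V6_3_half_eq_zero, V6_5_half_eq_zero]

theorem agreesWithPartitions_V7 : AgreesWithPartitions 7 V7 := by
  refine agreesWithPartitions_V6.succ (by norm_num) (fun s => ?_)
    (eq_zero_of_abs_le _ V7_neg fun k hk hk' => ?_)
  · norm_num [V7_recurrence]
  · interval_cases k
    all_goals first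
      | exact absurd hk' (by decide)
      | norm_num [V7_0_eq_zero, V7_1_eq_zero, V7_2_eq_zero, V7_3_eq_zero]

theorem agreesWithPartitions_V8 : AgreesWithPartitions 8 V8 := by
  refine agreesWithPartitions_V7.succ (by norm_num) (fun s => ?_)
    (eq_zero_of_abs_le _ V8_neg fun k hk hk' => ?_)
  · norm_num [V8_recurrence]
  · interval_cases k
    all_goals first
      | exact absurd hk' (by decide)
      | norm_num [V8_0_eq_zero, V8_1_eq_zero, V8_2_eq_zero, V8_3_eq_zero, V8_4_eq_zero]

theorem agreesWithPartitions_V9 : AgreesWithPartitions 9 V9 := by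
  refine agreesWithPartitions_V8.succ (by norm_num) (fun s => ?_)
    (eq_zero_of_abs_le _ V9_neg fun k hk hk' => ?_)
  · norm_num [V9_recurrence]
  · interval_cases k
    all_goals first
      | exact absurd hk' (by decide)
      | norm_num [V9_1_half_eq_zero, V9_3_half_eq_zero, V9_5_half_eq_zero, V9_7_half_eq_zero,
          V9_9_half_eq_zero]

theorem agreesWithPartitions_V10 : AgreesWithPartitions 10 V10 := by
  refine agreesWithPartitions_V9.succ (by norm_num) (fun s => ?_)
    (eq_zero_of_abs_le _ V10_neg fun k hk hk' => ?_)
  · norm_num [V10_recurrence]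
  · interval_cases k
    all_goals first
      | exact absurd hk' (by decide)
      | norm_num [V10_1_half_eq_zero, V10_3_half_eq_zero, V10_5_half_eq_zero, V10_7_half_eq_zero,
          V10_9_half_eq_zero]

end Agreement

/-! ### Existence and uniqueness of the wave -/

theorem agreesWithPartitions_waveFormula {m : ℕ} (hm : 1 ≤ m) (hm10 : m ≤ 10) :
    AgreesWithPartitions m (waveFormula m) := by
  interval_cases m
  exacts [agreesWithPartitions_V1, agreesWithPartitions_V2, agreesWithPartitions_V3,
    agreesWithPartitions_V4, agreesWithPartitions_V5, agreesWithPartitions_V6,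
    agreesWithPartitions_V7, agreesWithPartitions_V8, agreesWithPartitions_V9,
    agreesWithPartitions_V10]

theorem hasPeriodicCoeffs_waveFormula {m : ℕ} (hm : 1 ≤ m) (hm10 : m ≤ 10) :
    HasPeriodicCoeffs m (waveFormula m) := by
  interval_cases m
  exacts [hasPeriodicCoeffs_V1, hasPeriodicCoeffs_V2, hasPeriodicCoeffs_V3,
    hasPeriodicCoeffs_V4, hasPeriodicCoeffs_V5, hasPeriodicCoeffs_V6,
    hasPeriodicCoeffs_V7, hasPeriodicCoeffs_V8, hasPeriodicCoeffs_V9,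
    hasPeriodicCoeffs_V10]

theorem isSylvesterWave_waveFormula {m : ℕ} (hm : 1 ≤ m) (hm10 : m ≤ 10) :
    IsSylvesterWave m fun n => waveFormula m (n + shift m) := by
  refine ⟨(hasPeriodicCoeffs_waveFormula hm hm10).isQuasiPolynomial _, fun n => ?_⟩
  rw [← partitionNumberInt_natCast]
  refine agreesWithPartitions_waveFormula hm hm10 n ?_
  have hm' : (0 : ℝ) < m := by exact_mod_cast hm
  have : 0 ≤ (((n : ℕ) : ℤ) : ℝ) + shift m := by
    unfold shift
    positivity
  linarith

theorem IsSylvesterWave.eq {m : ℕ} {f g : ℤ → ℝ} (hf : IsSylvesterWave m f)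
    (hg : IsSylvesterWave m g) : f = g :=
  hf.1.eq_of_natCast hg.1 fun n => (hf.2 n).trans (hg.2 n).symm

end SylvesterWaves

theorem mainTheorem8 (m : ℕ) (hm : 1 ≤ m) (hm10 : m ≤ 10) :
    -- the coefficients of the Molien function are the restricted partition numbers
    (∀ n : ℕ, PowerSeries.coeff n (SylvesterWaves.molien m) =
      (SylvesterWaves.restrictedPartitionNumber m n : ℚ)) ∧
    -- the wave `W(·, 𝓢_m)` exists and is unique as a quasi-polynomial on `ℤ`
    (∃! W : ℤ → ℝ, SylvesterWaves.IsSylvesterWave m W) ∧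
    -- closed form of `V(s, 𝓢_m) = W(s - m(m+1)/4, 𝓢_m)` at every `s` for which it is defined
    (∀ W : ℤ → ℝ, SylvesterWaves.IsSylvesterWave m W →
      ∀ (n : ℤ) (s : ℝ), s - SylvesterWaves.shift m = (n : ℝ) →
        W n = SylvesterWaves.waveFormula m s) ∧
    -- in particular, for the restricted partition numbers themselves
    (∀ (n : ℕ) (s : ℝ), s - SylvesterWaves.shift m = (n : ℝ) →
      (SylvesterWaves.restrictedPartitionNumber m n : ℝ) = SylvesterWaves.waveFormula m s) ∧
    -- the coefficient of `s ^ (m - j)` in the closed form has the period `lcm(1, …, j)`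
    (∃ R : ℕ → ℝ → ℝ,
      (∀ j ∈ Finset.Icc 1 m, Function.Periodic (R j) (SylvesterWaves.lcmUpTo j : ℝ)) ∧
      ∀ s : ℝ, SylvesterWaves.waveFormula m s =
        ∑ j ∈ Finset.Icc 1 m, R j s * s ^ (m - j)) := by
  have hwave := SylvesterWaves.isSylvesterWave_waveFormula hm hm10
  refine ⟨SylvesterWaves.coeff_molien m, ⟨_, hwave, fun W hW => hW.eq hwave⟩, ?_, ?_,
    SylvesterWaves.hasPeriodicCoeffs_waveFormula hm hm10⟩
  · intro W hW n s hs
    simp only [hW.eq hwave, ← hs, sub_add_cancel]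
  · intro n s hs
    simp only [← hwave.2 n, Int.cast_natCast, ← hs, sub_add_cancel]
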